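/- **Theorem (time complexity of AESP-PPR).** Let $\mathcal G=(\mathcal V,\mathcal E)$ be a simple connected undirected graph with $m=|\mathcal E|$ edges and at least two nodes, with adjacency matrix $A$ and degree matrix $D$. Let $s\in\mathcal V$, $0<\alpha<1/2$ and $0<\epsilon<1/d_s$. The PPR vector $\pi$ is the solution of $\big(I-\tfrac{1-\alpha}{2}(I+AD^{-1})\big)\pi=\alpha e_s$. Put $Q=\tfrac{1+\alpha}{2}I-\tfrac{1-\alpha}{2}D^{-1/2}AD^{-1/2}$, $f(x)=\tfrac12x^\top Qx-\alpha x^\top D^{-1/2}e_s$, $\eta=1-2\alpha$. *Algorithm AESP-PPR.* Start with $x^{(0)}=y^{(0)}=0$. For $t=1,2,\dots,\big\lceil\tfrac{10}{9}\sqrt{\tfrac{1-\alpha}{\alpha}}\log\tfrac{400(1-\alpha^2)}{\alpha^2\epsilon^2}\big\rceil$ put $\varphi_t=\tfrac{1+\alpha}{18}\big(1-\tfrac{9}{10}\sqrt{\tfrac{\alpha}{1-\alpha}}\big)^t$ and $h_t(z)=f(z)+\tfrac{\eta}{2}\|z-y^{(t-1)}\|_2^2$, and let $x^{(t)}$ be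 the output of a local solver $\mathcal M$ applied to $h_t$ from $z_t^{(0)}=y^{(t-1)}$. Stop if no node $v$ has $\epsilon\alpha\sqrt{d_v}\le|\nabla_vf(x^{(t)})|$; otherwise put $y^{(t)}=x^{(t)}+\tfrac{\sqrt{1-\alpha}-\sqrt\alpha}{\sqrt{1-\alpha}+\sqrt\alpha}(x^{(t)}-x^{(t-1)})$. Return $\hat\pi=D^{1/2}x^{(T)}$, where $T$ is the number of outer iterations carried out. *Local solvers.* Let $C^0_{h_t}=\|D^{1/2}\nabla h_t(z_t^{(0)})\|_1$ and $\epsilon_t=\max\big\{\sqrt{(1-\alpha)\varphi_t/m},\,2(1-\alpha)\varphi_t/C^0_{h_t}\big\}$; if $C^0_{h_t}=0$, the solver returns $z_t^{(0)}$ at once. A node $u$ is active at $z$ if $|\nabla_uh_t(z)|\ge\epsilon_t\sqrt{d_u}$. In round $k$, LocGD subtracts $\tfrac{2}{1+\alpha+2\eta}\nabla_uh_t(z_t^{(k)})$ from $z_u$ simultaneously for all $u$ in the set $\mathcal S_t^{(k)}$ of active nodes, and it halts when that set is empty. LocAPPR keeps a first-in first-out queue, which holds the active nodes at first; it dequeues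 a node $u$, skips it if it is not active any more, and otherwise subtracts $\tfrac{2}{1+\alpha+2\eta}\nabla_uh_t(z)$ (gradient at the current $z$) from $z_u$ and enqueues those neighbours of $u$ (and $u$) that are then active and not in the queue; round $k$ deals with the content of the queue at the start of the round, $\mathcal S_t^{(k)}$ is the set of nodes updated in it, and the solver halts when the queue is empty. Let $K_t$ be the number of rounds, $\overline{\mathrm{vol}}(\mathcal S_t)=\tfrac1{K_t}\sum_{k<K_t}\mathrm{vol}(\mathcal S_t^{(k)})$ the average sum of degrees, and $\bar\gamma_t=\tfrac1{K_t}\sum_{k<K_t}\gamma_t^{(k)}$, where $\gamma_t^{(k)}$ is $\sum_{u\in\mathcal S_t^{(k)}}\sqrt{d_u}|\nabla_uh_t(z)|/\|D^{1/2}\nabla h_t(z)\|_1$, taken at $z=z_t^{(k)}$ for LocGD and, for each $u$, at the point $z$ just before the update of $u$ for LocAPPR. The time complexity is $\mathcal T=\sum_{t=1}^TK_t\,\overline{\mathrm{vol}}(\mathcal S_t)$. Let $R=\max_{t\in[T]}C^0_{h_t}/C^0_{h_1}$, let $T_{\max}$ be any maximizer of $\overline{\mathrm{vol}}(\mathcal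 S_t)/\bar\gamma_t$ over $t\in[T]$ (the ratio is $0$ if $K_t=0$), and let $\epsilon_{\min}$ be the smallest $\epsilon_t$ with $t\in[T]$, $C^0_{h_t}\ne0$. *Claim.* If $\mathcal M$ is LocGD or LocAPPR (with nodes and neighbours in any order), then every call of $\mathcal M$ terminates, $\|D^{-1}(\hat\pi-\pi)\|_\infty\le\epsilon$, and $$\mathcal T\le\min\Big\{\tilde O\Big(\tfrac{\overline{\mathrm{vol}}(\mathcal S_{T_{\max}})}{\sqrt\alpha\,\bar\gamma_{T_{\max}}}\Big),\ \tilde O\Big(\tfrac{\max_{t\in[T]}C^0_{h_t}}{\sqrt\alpha\,\epsilon_{\min}}\Big)\Big\}\quad\text{and}\quad\mathcal T\le\min\Big\{\tilde O\Big(\tfrac{m}{\sqrt\alpha}\Big),\ \tilde O\Big(\tfrac{R^2}{\sqrt\alpha\,\epsilon^2}\Big)\Big\},$$ where the quantities in the first minimum are bounded by those in the second: $\tfrac{\overline{\mathrm{vol}}(\mathcal S_{T_{\max}})}{\sqrt\alpha\,\bar\gamma_{T_{\max}}}=O\big(\tfrac{m}{\sqrt\alpha}\big)$ and $\tfrac{\max_tC^0_{h_t}}{\sqrt\alpha\,\epsilon_{\min}}=\tilde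 O\big(\tfrac{R^2}{\sqrt\alpha\,\epsilon^2}\big)$. Here $\tilde O(X)$ means at most $C\,X\log^p(\Lambda)$ with absolute constants $C$ and $p$, where $\Lambda=\tfrac{m}{\alpha\epsilon}$ in the first entry of each minimum, and $\Lambda=\tfrac1{\alpha\epsilon}$ (no dependence on the graph) everywhere else. -/

import Mathlib

noncomputable section

namespace AESP

/-! ### The graph, the PPR vector, the quadratic objective and its gradient -/

section Problem

variable {V : Type*} [Fintype V] [DecidableEq V] (G : SimpleGraph V) [DecidableRel G.Adj]

/-- The degree `d_v` as a real number. -/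
def deg (v : V) : ℝ := (G.degree v : ℝ)

/-- The number `m` of edges as a real number. -/
def numEdges : ℝ := (G.edgeFinset.card : ℝ)

/-- The volume of a set of nodes: the sum of the degrees. -/
def vol (S : Finset V) : ℝ := ∑ v ∈ S, deg G v

/-- The matrix `I - (1 - α) (I + A D⁻¹) / 2` of the PPR equation. -/
def pprMatrix (α : ℝ) : Matrix V V ℝ :=
  1 - ((1 - α) / 2) • (1 + G.adjMatrix ℝ * Matrix.diagonal (fun v => (deg G v)⁻¹))

/-- The PPR vector: the solution `π` of `(I - (1 - α) (I + A D⁻¹) / 2) π = α e_s`. -/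
def ppr (α : ℝ) (s : V) : V → ℝ :=
  (pprMatrix G α)⁻¹.mulVec (α • Pi.single s (1 : ℝ))

/-- `Q = (1 + α)/2 I - (1 - α)/2 D^{-1/2} A D^{-1/2}`. -/
def Q (α : ℝ) : Matrix V V ℝ :=
  ((1 + α) / 2) • (1 : Matrix V V ℝ) -
    ((1 - α) / 2) •
      (Matrix.diagonal (fun v => (Real.sqrt (deg G v))⁻¹) * G.adjMatrix ℝ *
        Matrix.diagonal (fun v => (Real.sqrt (deg G v))⁻¹))

/-- The gradient `∇f(x) = Q x - α D^{-1/2} e_s` of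
`f(x) = xᵀ Q x / 2 - α xᵀ D^{-1/2} e_s`. -/
def gradF (α : ℝ) (s : V) (x : V → ℝ) : V → ℝ := fun v =>
  (Q G α).mulVec x v - α * (Real.sqrt (deg G v))⁻¹ * (Pi.single s (1 : ℝ) : V → ℝ) v

/-- The gradient `∇h(z) = ∇f(z) + η (z - y)` of the proximal objective
`h(z) = f(z) + (η/2) ‖z - y‖₂²`. -/
def gradH (α : ℝ) (s : V) (η : ℝ) (y z : V → ℝ) : V → ℝ := fun v =>
  gradF G α s z v + η * (z v - y v)

/-- `‖∇h^{1/2}(z)‖₁ = ‖D^{1/2} ∇h(z)‖₁`. -/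
def gradNorm (α : ℝ) (s : V) (η : ℝ) (y z : V → ℝ) : ℝ :=
  ∑ v, |Real.sqrt (deg G v) * gradH G α s η y z v|

/-- The inner tolerance
`max (√((μ + η) φ / m)) (2 (η + α) φ / ‖∇h^{1/2}(z⁽⁰⁾)‖₁)`, with `μ = α` and `z⁽⁰⁾ = y`. -/
def innerTol (α : ℝ) (s : V) (η φ : ℝ) (y : V → ℝ) : ℝ :=
  max (Real.sqrt ((α + η) * φ / numEdges G))
    (2 * (η + α) * φ / gradNorm G α s η y y)

/-- Node `u` is active at `z` for the tolerance `e`: `e √d_u ≤ |∇_u h(z)|`. -/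
def Active (α : ℝ) (s : V) (η : ℝ) (y : V → ℝ) (e : ℝ) (z : V → ℝ) (u : V) : Prop :=
  e * Real.sqrt (deg G u) ≤ |gradH G α s η y z u|

end Problem

/-! ### Local solvers and their evolving set processes -/

/-- What is recorded of the evolving set process of one call of a local solver.
Round `k` starts at the point `z k` and processes the node set `S^{(k)}`. -/
structure ESP (V : Type*) where
  /-- the point `z^{(k)}` at the start of round `k` -/
  z : ℕ → V → ℝ
  /-- `vol (S^{(k)})` -/
  roundVol : ℕ → ℝ
  /-- the share of the gradient norm that is carried by the nodes processed in round `k` -/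
  roundGamma : ℕ → ℝ
  /-- at the start of round `k` no node is left to be processed -/
  halted : ℕ → Prop

namespace ESP

variable {V : Type*} (P : ESP V)

/-- The number `K` of rounds until the solver halts. -/
def rounds : ℕ := sInf {k | P.halted k}

/-- The returned point `z^{(K)}`. -/
def output : V → ℝ := P.z P.rounds

/-- The average volume `(1/K) ∑_{k < K} vol (S^{(k)})`. -/
def avgVol : ℝ := (1 / (P.rounds : ℝ)) * ∑ k ∈ Finset.range P.rounds, P.roundVol k

/-- The average active ratio `(1/K) ∑_{k < K} γ^{(k)}`. -/
def avgGamma : ℝ := (1 / (P.rounds : ℝ)) * ∑ k ∈ Finset.range P.rounds, P.roundGamma k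

/-- The time complexity of the call: `K` times the average volume. -/
def work : ℝ := (P.rounds : ℝ) * P.avgVol

end ESP

section LocGD

variable {V : Type*} [Fintype V] [DecidableEq V] (G : SimpleGraph V) [DecidableRel G.Adj]

open Classical in
/-- The set of all active nodes at `z`. -/
def activeSet (α : ℝ) (s : V) (η : ℝ) (y : V → ℝ) (e : ℝ) (z : V → ℝ) : Finset V :=
  Finset.univ.filter (fun u => Active G α s η y e z u)

/-- One step of local gradient descent:
`z - 2 / (1 + α + 2 η) • (∇h(z) ∘ 1_S)` with `S` the active set. -/
def locGDStep (α : ℝ) (s : V) (η : ℝ) (y : V → ℝ) (e : ℝ) (z : V → ℝ) : V → ℝ := fun u =>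
  if u ∈ activeSet G α s η y e z then
    z u - 2 * gradH G α s η y z u / (1 + α + 2 * η)
  else z u

/-- The process of LocGD with accuracy `φ`, started at `y`. If `∇h(y) = 0`, then it halts at
once (in round `0`) with output `y`. -/
def locGD (α : ℝ) (s : V) (η φ : ℝ) (y : V → ℝ) : ESP V :=
  let e := innerTol G α s η φ y
  let z : ℕ → V → ℝ := fun k => (locGDStep G α s η y e)^[k] y
  let S : ℕ → Finset V := fun k => activeSet G α s η y e (z k)
  { z := z
    roundVol := fun k => vol G (S k)
    roundGamma := fun k =>
      (∑ u ∈ S k, |Real.sqrt (deg G u) * gradH G α s η y (z k) u|) /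
        gradNorm G α s η y (z k)
    halted := fun k => S k = ∅ }

end LocGD

/-- The graph as the algorithm reads it: a list of the nodes and an adjacency list for every
node, in any order. The orders decide in which order LocAPPR puts nodes into its queue. -/
structure AdjLists {V : Type*} (G : SimpleGraph V) where
  /-- the nodes -/
  nodes : List V
  nodes_nodup : nodes.Nodup
  mem_nodes : ∀ v, v ∈ nodes
  /-- the neighbours of a node -/
  nbrs : V → List V
  nbrs_nodup : ∀ u, (nbrs u).Nodup
  mem_nbrs : ∀ u v, v ∈ nbrs u ↔ G.Adj u v

section LocAPPR

variable {V : Type*} [Fintype V] [DecidableEq V] (G : SimpleGraph V) [DecidableRel G.Adj]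

/-- The update of the single coordinate `u`:
`z - 2 / (1 + α + 2 η) • (∇h(z) ∘ 1_{u})`. -/
def push (α : ℝ) (s : V) (η : ℝ) (y z : V → ℝ) (u : V) : V → ℝ :=
  Function.update z u (z u - 2 * gradH G α s η y z u / (1 + α + 2 * η))

open Classical in
/-- Go through the candidates `cs` and append to `next` those that are active at `z` and not
yet in the queue `rest ++ next`. -/
def enqueue (α : ℝ) (s : V) (η : ℝ) (y : V → ℝ) (e : ℝ) (z : V → ℝ) (rest : List V) :
    List V → List V → List V
  | [], next => next
  | v :: cs, next =>
    if Active G α s η y e z v ∧ v ∉ rest ∧ v ∉ next then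
      enqueue α s η y e z rest cs (next ++ [v])
    else enqueue α s η y e z rest cs next

open Classical in
/-- One round of LocAPPR. The first-in first-out queue is `rest ++ next`, where `rest` holds
what is left of the queue from the start of the round. A dequeued node is skipped if it is not
active any more. Otherwise its coordinate is updated, and its neighbours and the node itself are
put into the queue if they are active now and not in it. The result is the new point, the queue
for the next round, and the list of the nodes `u_i` that were updated, each with its ratio
`γ^{(k_i)} = ‖∇h^{1/2}(z^{(k_i)}) ∘ 1_{u_i}‖₁ / ‖∇h^{1/2}(z^{(k_i)})‖₁`. -/
def apprRound (L : AdjLists G) (α : ℝ) (s : V) (η : ℝ) (y : V → ℝ) (e : ℝ) :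
    List V → (V → ℝ) → List V → (V → ℝ) × List V × List (V × ℝ)
  | [], z, next => (z, next, [])
  | u :: rest, z, next =>
    if Active G α s η y e z u then
      let z' := push G α s η y z u
      let next' := enqueue G α s η y e z' rest (L.nbrs u ++ [u]) next
      let r := apprRound L α s η y e rest z' next'
      (r.1, r.2.1,
        (u, |Real.sqrt (deg G u) * gradH G α s η y z u| / gradNorm G α s η y z) :: r.2.2)
    else apprRound L α s η y e rest z next

open Classical in
/-- The point and the queue of LocAPPR at the start of round `k`. The first queue holds the
active nodes at `y`. -/
def apprState (L : AdjLists G) (α : ℝ) (s : V) (η : ℝ) (y : V → ℝ) (e : ℝ) :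
    ℕ → (V → ℝ) × List V
  | 0 => (y, L.nodes.filter (fun u => decide (Active G α s η y e y u)))
  | k + 1 =>
    let st := apprState L α s η y e k
    let r := apprRound G L α s η y e st.2 st.1 []
    (r.1, r.2.1)

/-- The process of LocAPPR with accuracy `φ`, started at `y`. If `∇h(y) = 0`, then it halts at
once (in round `0`) with output `y`. -/
def locAPPR (L : AdjLists G) (α : ℝ) (s : V) (η φ : ℝ) (y : V → ℝ) : ESP V :=
  let e := innerTol G α s η φ y
  let st : ℕ → (V → ℝ) × List V := apprState G L α s η y e
  let done : ℕ → List (V × ℝ) := fun k => (apprRound G L α s η y e (st k).2 (st k).1 []).2.2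
  { z := fun k => (st k).1
    roundVol := fun k => ((done k).map (fun w => deg G w.1)).sum
    roundGamma := fun k => ((done k).map (fun w => w.2)).sum
    halted := fun k => (st k).2 = [] }

end LocAPPR

/-- The two local solvers. -/
inductive LocalSolver where
  | locGD
  | locAPPR

/-! ### AESP-PPR -/

section AESPPPR

variable {V : Type*} [Fintype V] [DecidableEq V] {G : SimpleGraph V} [DecidableRel G.Adj]

/-- A call of the chosen local solver. -/
def LocalSolver.call (M : LocalSolver) (L : AdjLists G) (α : ℝ) (s : V) (η φ : ℝ)
    (y : V → ℝ) : ESP V :=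
  match M with
  | .locGD => AESP.locGD G α s η φ y
  | .locAPPR => AESP.locAPPR G L α s η φ y

/-- The maximal number of outer iterations,
`⌈(10/9) √((1 - α)/α) log (400 (1 - α²) / (α² ε²))⌉`. -/
def maxOuter (α ε : ℝ) : ℕ :=
  ⌈(10 / 9) * Real.sqrt ((1 - α) / α) * Real.log (400 * (1 - α ^ 2) / (α ^ 2 * ε ^ 2))⌉₊

/-- The accuracy `φ_t = (1 + α)/18 (1 - (9/10) √(α/(1 - α)))^t`. -/
def accuracy (α : ℝ) (t : ℕ) : ℝ :=
  (1 + α) / 18 * (1 - 9 / 10 * Real.sqrt (α / (1 - α))) ^ t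

/-- The momentum weight `(√(1 - α) - √α) / (√(1 - α) + √α)`. -/
def momentum (α : ℝ) : ℝ :=
  (Real.sqrt (1 - α) - Real.sqrt α) / (Real.sqrt (1 - α) + Real.sqrt α)

/-- The pair `(x^{(t)}, y^{(t)})` after `t` outer iterations, with `η = 1 - 2 α`. -/
def iterate (M : LocalSolver) (L : AdjLists G) (α : ℝ) (s : V) : ℕ → (V → ℝ) × (V → ℝ)
  | 0 => (0, 0)
  | t + 1 =>
    let p := iterate M L α s t
    let x := (M.call L α s (1 - 2 * α) (accuracy α (t + 1)) p.2).output
    (x, x + momentum α • (x - p.1))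

/-- The evolving set process of outer iteration `t ≥ 1`. -/
def process (M : LocalSolver) (L : AdjLists G) (α : ℝ) (s : V) (t : ℕ) : ESP V :=
  M.call L α s (1 - 2 * α) (accuracy α t) (iterate M L α s (t - 1)).2

/-- The test for the early stop after outer iteration `t`:
no node `v` has `ε α √d_v ≤ |∇_v f(x^{(t)})|`. -/
def Stops (M : LocalSolver) (L : AdjLists G) (α ε : ℝ) (s : V) (t : ℕ) : Prop :=
  {v | ε * α * Real.sqrt (deg G v) ≤ |gradF G α s (iterate M L α s t).1 v|} = ∅

/-- The number `T` of outer iterations that are carried out. -/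
def numOuter (M : LocalSolver) (L : AdjLists G) (α ε : ℝ) (s : V) : ℕ :=
  sInf {t | 1 ≤ t ∧ (t = maxOuter α ε ∨ Stops M L α ε s t)}

/-- The returned vector `D^{1/2} x^{(T)}`. -/
def result (M : LocalSolver) (L : AdjLists G) (α ε : ℝ) (s : V) : V → ℝ := fun v =>
  Real.sqrt (deg G v) * (iterate M L α s (numOuter M L α ε s)).1 v

/-- The total time complexity `∑_{t=1}^T K_t · avgVol_t`. -/
def totalWork (M : LocalSolver) (L : AdjLists G) (α ε : ℝ) (s : V) : ℝ :=
  ∑ t ∈ Finset.Icc 1 (numOuter M L α ε s), (process M L α s t).work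

/-- `C_{h_t}^0 = ‖∇h_t^{1/2}(z_t^{(0)})‖₁`, where `z_t^{(0)} = y^{(t-1)}`. -/
def initNorm (M : LocalSolver) (L : AdjLists G) (α : ℝ) (s : V) (t : ℕ) : ℝ :=
  gradNorm G α s (1 - 2 * α) (iterate M L α s (t - 1)).2 (iterate M L α s (t - 1)).2

/-- `ε_t`, the tolerance of outer iteration `t`. -/
def tol (M : LocalSolver) (L : AdjLists G) (α : ℝ) (s : V) (t : ℕ) : ℝ :=
  innerTol G α s (1 - 2 * α) (accuracy α t) (iterate M L α s (t - 1)).2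

/-- The ratio of average volume to average active ratio in outer iteration `t`
(it is `0` if that iteration has no round). -/
def volRatio (M : LocalSolver) (L : AdjLists G) (α : ℝ) (s : V) (t : ℕ) : ℝ :=
  (process M L α s t).avgVol / (process M L α s t).avgGamma

/-- `max_{t ∈ [T]} C_{h_t}^0`. -/
def maxInitNorm (M : LocalSolver) (L : AdjLists G) (α ε : ℝ) (s : V) : ℝ :=
  sSup (initNorm M L α s '' Set.Icc 1 (numOuter M L α ε s))

/-- The smallest of the tolerances `ε_t`, `t ∈ [T]`. An iteration with `C_{h_t}^0 = 0` returns
its starting point before it computes a tolerance, and is left out. -/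
def minTol (M : LocalSolver) (L : AdjLists G) (α ε : ℝ) (s : V) : ℝ :=
  sInf (tol M L α s '' {t ∈ Set.Icc 1 (numOuter M L α ε s) | initNorm M L α s t ≠ 0})

/-- `R = max_{t ∈ [T]} ‖∇h_t^{1/2}(z_t^{(0)})‖₁ / ‖∇h_1^{1/2}(z_1^{(0)})‖₁`. -/
def ratioR (M : LocalSolver) (L : AdjLists G) (α ε : ℝ) (s : V) : ℝ :=
  sSup ((fun t => initNorm M L α s t / initNorm M L α s 1) ''
    Set.Icc 1 (numOuter M L α ε s))

end AESPPPR

end AESP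

end

/-! Inner loop. Put g = D^{1/2}∇h_t. Since η = 1 - 2α, the step length 2/(1+α+2η) = 2/(3(1-α)) is
the inverse of the diagonal entry of the Hessian of h_t. An update of u therefore annihilates g_u
and passes g_u/(3 d_u) to each neighbour, so ‖g‖₁ falls by at least 2/3 of the processed mass
(`gradNorm_stepOn_le`). An active node carries mass at least ε_t d_u, hence a call costs at most
(3/2) C⁰/ε_t. Measured relative to ‖g‖₁, the logarithm of the norm falls by 2/3 of γ per round, so
Σγ is logarithmic in C⁰/ε_t, and the work of a call is (average volume / average γ) · Σγ.
Unprocessed nodes carry little mass, which bounds this ratio by 8m/3. `IsLocalRun` collects what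
LocGD and LocAPPR share, and the cost bounds are drawn from it alone.

Outer loop. With a = √(α/(1-α)) this is an inexact accelerated proximal point method. Its Lyapunov
function, half the Q-form of the error plus α/2 times a squared momentum term, would contract by 1 -
a. The tolerance ε_t forces ‖∇h_t‖² ≤ 2(1-α)φ_t at the output, and this error costs only the gap
between the rates 1 - a and c = 1 - (9/10)a (`iterate_bound`). At the maximal number of iterations
this yields the accuracy; at an early stop a maximum principle for the random walk does.

Total cost. With ℓ = log(1/(αε)), T = O(ℓ/√α), which multiplies the cost of a call. For the
graph-independent bound, ε_min is at least c^T/(18 max C⁰), and max C⁰ ≤ αR because C⁰_{h_1} = α. It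
remains to see that c^T is not much below α²ε² (`sq_le_contraction_pow_numOuter`). For α ≤ ℓ⁻² this
follows from the cap on T. For larger α, the failure of the stopping test at T - 1 gives a bound
that is weaker by a factor α, and ℓ² pays for it. -/

noncomputable section

namespace AESP

open Finset Matrix

set_option linter.unusedSectionVars false

/-! ### Spectral bounds α ≤ Q ≤ 1 -/

section Spectral

variable {V : Type*} [Fintype V] [DecidableEq V] {G : SimpleGraph V} [DecidableRel G.Adj]

theorem one_le_deg [Nontrivial V] (hG : G.Connected) (v : V) : 1 ≤ deg G v := by
  have h := hG.preconnected.degree_pos_of_nontrivial v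
  unfold deg
  exact_mod_cast h

theorem sum_deg : ∑ v, deg G v = 2 * numEdges G := by
  unfold deg numEdges
  have h := G.sum_degrees_eq_twice_card_edges
  exact_mod_cast h

theorem sum_adjMatrix_row (v : V) : ∑ u, G.adjMatrix ℝ v u = deg G v := by
  simp [SimpleGraph.adjMatrix_apply, deg, ← SimpleGraph.card_neighborFinset_eq_degree,
    SimpleGraph.neighborFinset_eq_filter]

theorem adjMatrix_symm (v u : V) : G.adjMatrix ℝ v u = G.adjMatrix ℝ u v := by
  simp [SimpleGraph.adjMatrix_apply, G.adj_comm]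

theorem sum_adjMatrix_col (u : V) : ∑ v, G.adjMatrix ℝ v u = deg G u := by
  rw [← sum_adjMatrix_row u]
  exact sum_congr rfl fun v _ => adjMatrix_symm v u

theorem adjMatrix_nonneg (v u : V) : 0 ≤ G.adjMatrix ℝ v u := by
  rw [SimpleGraph.adjMatrix_apply]; split_ifs <;> norm_num

theorem Q_mulVec_apply (α : ℝ) (x : V → ℝ) (v : V) :
    (Q G α *ᵥ x) v = (1 + α) / 2 * x v -
      (1 - α) / 2 * ∑ u, (√(deg G v))⁻¹ * G.adjMatrix ℝ v u * (√(deg G u))⁻¹ * x u := by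
  unfold Q
  rw [sub_mulVec, smul_mulVec, smul_mulVec, one_mulVec]
  simp only [Pi.sub_apply, Pi.smul_apply, smul_eq_mul]
  congr 2
  simp only [mulVec, dotProduct, mul_diagonal, diagonal_mul]

theorem Q_isSymm (α : ℝ) : (Q G α)ᵀ = Q G α := by
  unfold Q
  rw [transpose_sub, transpose_smul, transpose_smul, transpose_one, transpose_mul, transpose_mul,
    diagonal_transpose, SimpleGraph.transpose_adjMatrix, Matrix.mul_assoc]

theorem dotProduct_Q_comm (α : ℝ) (x y : V → ℝ) : x ⬝ᵥ Q G α *ᵥ y = y ⬝ᵥ Q G α *ᵥ x := by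
  rw [dotProduct_mulVec, ← mulVec_transpose, Q_isSymm, dotProduct_comm]

theorem dotProduct_Q_sub (α : ℝ) (x y : V → ℝ) :
    (x - y) ⬝ᵥ Q G α *ᵥ (x - y) =
      x ⬝ᵥ Q G α *ᵥ x - 2 * (x ⬝ᵥ Q G α *ᵥ y) + y ⬝ᵥ Q G α *ᵥ y := by
  rw [mulVec_sub, sub_dotProduct, dotProduct_sub, dotProduct_sub, dotProduct_Q_comm α y x]
  ring

theorem sum_adjMatrix_mul_sq (hd : ∀ v, 1 ≤ deg G v) (z : V → ℝ) :
    ∑ v, ∑ u, G.adjMatrix ℝ v u * (z v ^ 2 / deg G v) = ∑ v, z v ^ 2 := by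
  refine sum_congr rfl fun v _ => ?_
  rw [← sum_mul, sum_adjMatrix_row]
  have := hd v
  field_simp

/-- Apply 2|xy| ≤ x² + y² on each edge to x = z_v/√d_v and y = z_u/√d_u; each node then collects
z_v²/d_v once per neighbour, that is z_v² in total. -/
theorem abs_normalized_adj_form_le (hd : ∀ v, 1 ≤ deg G v) (z : V → ℝ) :
    |∑ v, z v * ∑ u, (√(deg G v))⁻¹ * G.adjMatrix ℝ v u * (√(deg G u))⁻¹ * z u| ≤
      ∑ v, z v ^ 2 := by
  have h1 := sum_adjMatrix_mul_sq hd z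
  have h2 : ∑ v, ∑ u, G.adjMatrix ℝ v u * (z u ^ 2 / deg G u) = ∑ v, z v ^ 2 := by
    rw [sum_comm, ← h1]
    exact sum_congr rfl fun v _ => sum_congr rfl fun u _ => by rw [adjMatrix_symm]
  have h3 : ∑ v, z v ^ 2 = ∑ v, ∑ u, G.adjMatrix ℝ v u *
      ((z v ^ 2 / deg G v + z u ^ 2 / deg G u) / 2) := by
    have : ∑ v, ∑ u, G.adjMatrix ℝ v u * ((z v ^ 2 / deg G v + z u ^ 2 / deg G u) / 2) =
        (∑ v, ∑ u, G.adjMatrix ℝ v u * (z v ^ 2 / deg G v) +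
          ∑ v, ∑ u, G.adjMatrix ℝ v u * (z u ^ 2 / deg G u)) / 2 := by
      rw [← sum_add_distrib, sum_div]
      refine sum_congr rfl fun v _ => ?_
      rw [← sum_add_distrib, sum_div]
      exact sum_congr rfl fun u _ => by ring
    rw [this, h1, h2]; ring
  rw [h3]
  refine (abs_sum_le_sum_abs _ _).trans (sum_le_sum fun v _ => ?_)
  rw [mul_sum]
  refine (abs_sum_le_sum_abs _ _).trans (sum_le_sum fun u _ => ?_)
  have e1 : z v ^ 2 / deg G v = (z v * (√(deg G v))⁻¹) ^ 2 := by
    rw [mul_pow, inv_pow, Real.sq_sqrt (by linarith [hd v])]; rfl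
  have e2 : z u ^ 2 / deg G u = (z u * (√(deg G u))⁻¹) ^ 2 := by
    rw [mul_pow, inv_pow, Real.sq_sqrt (by linarith [hd u])]; rfl
  have e3 : z v * ((√(deg G v))⁻¹ * G.adjMatrix ℝ v u * (√(deg G u))⁻¹ * z u) =
      G.adjMatrix ℝ v u * ((z v * (√(deg G v))⁻¹) * (z u * (√(deg G u))⁻¹)) := by ring
  rw [e1, e2, e3, abs_mul, abs_of_nonneg (adjMatrix_nonneg v u)]
  refine mul_le_mul_of_nonneg_left ?_ (adjMatrix_nonneg v u)
  rw [abs_le]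
  constructor
  · nlinarith [sq_nonneg (z v * (√(deg G v))⁻¹ + z u * (√(deg G u))⁻¹)]
  · nlinarith [sq_nonneg (z v * (√(deg G v))⁻¹ - z u * (√(deg G u))⁻¹)]

theorem Q_form_eq (α : ℝ) (z : V → ℝ) :
    z ⬝ᵥ Q G α *ᵥ z = (1 + α) / 2 * ∑ v, z v ^ 2 - (1 - α) / 2 *
      ∑ v, z v * ∑ u, (√(deg G v))⁻¹ * G.adjMatrix ℝ v u * (√(deg G u))⁻¹ * z u := by
  simp only [dotProduct, Q_mulVec_apply]
  rw [mul_sum, mul_sum, ← sum_sub_distrib]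
  exact sum_congr rfl fun v _ => by ring

theorem le_Q_form (hd : ∀ v, 1 ≤ deg G v) {α : ℝ} (hα1 : α < 1) (z : V → ℝ) :
    α * ∑ v, z v ^ 2 ≤ z ⬝ᵥ Q G α *ᵥ z := by
  have h := (abs_le.1 (abs_normalized_adj_form_le hd z)).2
  rw [Q_form_eq]
  nlinarith

theorem Q_form_le (hd : ∀ v, 1 ≤ deg G v) {α : ℝ} (hα1 : α < 1) (z : V → ℝ) :
    z ⬝ᵥ Q G α *ᵥ z ≤ ∑ v, z v ^ 2 := by
  have h := (abs_le.1 (abs_normalized_adj_form_le hd z)).1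
  rw [Q_form_eq]
  nlinarith

/-- This is Q² ≤ Q, from 0 ≤ Q ≤ 1 without diagonalization: expand the nonnegative form at z - Qz
and bound its cubic term by Q³ ≤ Q². -/
theorem sum_sq_Q_mulVec_le (hd : ∀ v, 1 ≤ deg G v) {α : ℝ} (hα : 0 < α) (hα1 : α < 1)
    (z : V → ℝ) : ∑ v, (Q G α *ᵥ z) v ^ 2 ≤ z ⬝ᵥ Q G α *ᵥ z := by
  have h1 := le_Q_form hd hα1 (z - Q G α *ᵥ z)
  have h2 := Q_form_le hd hα1 (Q G α *ᵥ z)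
  rw [dotProduct_Q_sub, dotProduct_Q_comm α z (Q G α *ᵥ z)] at h1
  have h3 : (Q G α *ᵥ z) ⬝ᵥ Q G α *ᵥ z = ∑ v, (Q G α *ᵥ z) v ^ 2 := by
    simp only [dotProduct, sq]
  have h4 : 0 ≤ α * ∑ v, (z - Q G α *ᵥ z) v ^ 2 :=
    mul_nonneg hα.le (sum_nonneg fun v _ => sq_nonneg _)
  linarith

end Spectral

/-! ### Effect of a gradient step on the scaled gradient -/

section Step

variable {V : Type*} [Fintype V] [DecidableEq V] {G : SimpleGraph V} [DecidableRel G.Adj]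

/-- The scaled gradient `D^{1/2} ∇h(z)` for `η = 1 - 2 α`. -/
def scaledGrad (G : SimpleGraph V) [DecidableRel G.Adj] (α : ℝ) (s : V) (y z : V → ℝ) (v : V) :
    ℝ :=
  √(deg G v) * gradH G α s (1 - 2 * α) y z v

theorem gradNorm_eq (α : ℝ) (s : V) (y z : V → ℝ) :
    gradNorm G α s (1 - 2 * α) y z = ∑ v, |scaledGrad G α s y z v| := rfl

theorem gradNorm_nonneg (α : ℝ) (s : V) (η : ℝ) (y z : V → ℝ) : 0 ≤ gradNorm G α s η y z :=
  sum_nonneg fun _ _ => abs_nonneg _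

theorem abs_scaledGrad_le_gradNorm (α : ℝ) (s : V) (y z : V → ℝ) (u : V) :
    |scaledGrad G α s y z u| ≤ gradNorm G α s (1 - 2 * α) y z :=
  single_le_sum (f := fun v => |scaledGrad G α s y z v|) (fun _ _ => abs_nonneg _) (mem_univ u)

theorem active_iff (hd : ∀ v, 1 ≤ deg G v) (α : ℝ) (s : V) (y : V → ℝ) (e : ℝ) (z : V → ℝ)
    (u : V) : Active G α s (1 - 2 * α) y e z u ↔ e * deg G u ≤ |scaledGrad G α s y z u| := by
  unfold Active scaledGrad
  have h0 : 0 < √(deg G u) := Real.sqrt_pos.2 (by linarith [hd u])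
  have h1 : deg G u = √(deg G u) * √(deg G u) := (Real.mul_self_sqrt (by linarith [hd u])).symm
  rw [abs_mul, abs_of_pos h0]
  nth_rewrite 2 [h1]
  rw [← mul_assoc, mul_comm (√(deg G u)) |_|]
  exact (mul_le_mul_iff_left₀ h0).symm

/-- The point that arises from `z` when the coordinates in `S` make a gradient step. -/
def stepOn (G : SimpleGraph V) [DecidableRel G.Adj] (α : ℝ) (s : V) (y z : V → ℝ)
    (S : Finset V) : V → ℝ := fun u =>
  if u ∈ S then z u - 2 * gradH G α s (1 - 2 * α) y z u / (1 + α + 2 * (1 - 2 * α)) else z u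

theorem push_eq_stepOn (α : ℝ) (s : V) (y z : V → ℝ) (u : V) :
    push G α s (1 - 2 * α) y z u = stepOn G α s y z {u} := by
  funext v
  unfold push stepOn
  by_cases h : v = u
  · subst h; simp
  · simp [h]

theorem locGDStep_eq_stepOn (α : ℝ) (s : V) (y : V → ℝ) (e : ℝ) (z : V → ℝ) :
    locGDStep G α s (1 - 2 * α) y e z =
      stepOn G α s y z (activeSet G α s (1 - 2 * α) y e z) := rfl

/-- The diagonal entry (1+α)/2 + η = 3(1-α)/2 of the Hessian times the step length is 1, so the
stepped coordinates lose their own gradient; the off-diagonal factor (1-α)/2 times the step length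
is 1/3. -/
theorem scaledGrad_stepOn (hd : ∀ v, 1 ≤ deg G v) {α : ℝ} (hα1 : α < 1) (s : V)
    (y z : V → ℝ) (S : Finset V) (v : V) :
    scaledGrad G α s y (stepOn G α s y z S) v =
      (if v ∈ S then 0 else scaledGrad G α s y z v) +
        1 / 3 * ∑ u ∈ S, G.adjMatrix ℝ v u * (scaledGrad G α s y z u / deg G u) := by
  set g := gradH G α s (1 - 2 * α) y z with hg
  have hne : (1 : ℝ) - α ≠ 0 := by linarith
  have hsq : ∀ u, √(deg G u) ≠ 0 := fun u => (Real.sqrt_pos.2 (by linarith [hd u])).ne'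
  have hden : 1 + α + 2 * (1 - 2 * α) = 3 * (1 - α) := by ring
  have hz : ∀ u, stepOn G α s y z S u = z u - if u ∈ S then 2 / (3 * (1 - α)) * g u else 0 := by
    intro u
    unfold stepOn
    rw [hden]
    split_ifs
    · rw [hg]; ring
    · ring
  have hsum : ∑ u, (√(deg G v))⁻¹ * G.adjMatrix ℝ v u * (√(deg G u))⁻¹ * stepOn G α s y z S u =
      ∑ u, (√(deg G v))⁻¹ * G.adjMatrix ℝ v u * (√(deg G u))⁻¹ * z u -
        2 / (3 * (1 - α)) * ((√(deg G v))⁻¹ *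
          ∑ u ∈ S, G.adjMatrix ℝ v u * (scaledGrad G α s y z u / deg G u)) := by
    rw [eq_sub_iff_add_eq, ← eq_sub_iff_add_eq', ← sum_sub_distrib, ← sum_filter_add_sum_filter_not
      univ (· ∈ S)]
    rw [mul_sum, mul_sum]
    have hS : univ.filter (· ∈ S) = S := by ext; simp
    rw [hS]
    rw [sum_eq_zero (s := univ.filter (· ∉ S)), add_zero]
    · refine sum_congr rfl fun u hu => ?_
      rw [hz, if_pos hu]
      unfold scaledGrad
      rw [← hg]
      have : deg G u = √(deg G u) * √(deg G u) := (Real.mul_self_sqrt (by linarith [hd u])).symm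
      have e : √(deg G u) * g u / deg G u = (√(deg G u))⁻¹ * g u := by
        rw [this]
        have := hsq u
        rw [Real.sqrt_mul_self (Real.sqrt_nonneg _)]
        field_simp
      rw [e]; ring
    · intro u hu
      rw [hz, if_neg (mem_filter.1 hu).2]; ring
  unfold scaledGrad gradH gradF
  rw [Q_mulVec_apply, hsum, hz]
  have hgv : g v = gradH G α s (1 - 2 * α) y z v := rfl
  unfold gradH gradF at hgv
  rw [Q_mulVec_apply] at hgv
  have key : ∀ c : ℝ, √(deg G v) * ((√(deg G v))⁻¹ * c) = c := fun c => by
    rw [← mul_assoc, mul_inv_cancel₀ (hsq v), one_mul]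
  set T := ∑ u ∈ S, G.adjMatrix ℝ v u * (scaledGrad G α s y z u / deg G u)
  have hT : ∑ u ∈ S, G.adjMatrix ℝ v u * (√(deg G u) *
      ((Q G α *ᵥ z) u - α * (√(deg G u))⁻¹ * (Pi.single s (1 : ℝ) : V → ℝ) u +
        (1 - 2 * α) * (z u - y u)) / deg G u) = T := rfl
  rw [hT, Q_mulVec_apply]
  have hT3 : 1 / 3 * T = √(deg G v) * ((√(deg G v))⁻¹ * (1 / 3 * T)) := (key _).symm
  rw [hT3]
  have h2 : (1 - α) / 2 * (2 / (3 * (1 - α))) = 1 / 3 := by field_simp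
  have h3 : (3 * (1 - α) / 2) * (2 / (3 * (1 - α))) = 1 := by field_simp
  split_ifs
  · rw [zero_add]
    congr 1
    linear_combination (-g v) * h3 - hgv + h2 * ((√(deg G v))⁻¹ * T)
  · rw [← mul_add]
    congr 1
    linear_combination h2 * ((√(deg G v))⁻¹ * T)

theorem sum_abs_adjMatrix_mul_le (hd : ∀ v, 1 ≤ deg G v) (S : Finset V) (w : V → ℝ) :
    ∑ v, |∑ u ∈ S, G.adjMatrix ℝ v u * (w u / deg G u)| ≤ ∑ u ∈ S, |w u| := by
  calc ∑ v, |∑ u ∈ S, G.adjMatrix ℝ v u * (w u / deg G u)|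
      ≤ ∑ v, ∑ u ∈ S, G.adjMatrix ℝ v u * (|w u| / deg G u) := by
        refine sum_le_sum fun v _ => (abs_sum_le_sum_abs _ _).trans (sum_le_sum fun u _ => ?_)
        rw [abs_mul, abs_div, abs_of_nonneg (adjMatrix_nonneg v u),
          abs_of_nonneg (by linarith [hd u] : (0 : ℝ) ≤ deg G u)]
    _ = ∑ u ∈ S, |w u| := by
        rw [sum_comm]
        refine sum_congr rfl fun u _ => ?_
        rw [← sum_mul, sum_adjMatrix_col]
        have := hd u
        field_simp

/-- All the mass on S vanishes, and at most a third of it reappears at neighbours. -/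
theorem gradNorm_stepOn_le (hd : ∀ v, 1 ≤ deg G v) {α : ℝ} (hα1 : α < 1) (s : V)
    (y z : V → ℝ) (S : Finset V) :
    gradNorm G α s (1 - 2 * α) y (stepOn G α s y z S) ≤
      gradNorm G α s (1 - 2 * α) y z - 2 / 3 * ∑ u ∈ S, |scaledGrad G α s y z u| := by
  have h := sum_abs_adjMatrix_mul_le hd S (scaledGrad G α s y z)
  have h1 : ∑ v, |if v ∈ S then 0 else scaledGrad G α s y z v| =
      ∑ v, |scaledGrad G α s y z v| - ∑ u ∈ S, |scaledGrad G α s y z u| := by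
    rw [eq_sub_iff_add_eq, ← sum_filter_add_sum_filter_not univ (· ∈ S),
      ← sum_filter_add_sum_filter_not univ (· ∈ S) (fun v => |scaledGrad G α s y z v|)]
    have hS : univ.filter (· ∈ S) = S := by ext; simp
    rw [hS, sum_congr rfl (g := fun _ => (0 : ℝ)) (fun v hv => by rw [if_pos hv, abs_zero]),
      sum_congr (s₁ := univ.filter (· ∉ S)) rfl (g := fun v => |scaledGrad G α s y z v|)
        (fun v hv => by rw [if_neg (mem_filter.1 hv).2])]
    simp only [sum_const_zero]; ring
  rw [gradNorm_eq, gradNorm_eq]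
  calc ∑ v, |scaledGrad G α s y (stepOn G α s y z S) v|
      ≤ ∑ v, (|if v ∈ S then 0 else scaledGrad G α s y z v| +
          1 / 3 * |∑ u ∈ S, G.adjMatrix ℝ v u * (scaledGrad G α s y z u / deg G u)|) := by
        refine sum_le_sum fun v _ => ?_
        rw [scaledGrad_stepOn hd hα1]
        refine (abs_add_le _ _).trans ?_
        rw [abs_mul, abs_of_pos (by norm_num : (0 : ℝ) < 1 / 3)]
    _ ≤ _ := by
        rw [sum_add_distrib, h1, ← mul_sum]
        linarith

/-- Reverse comparison: a step on S can cancel on W at most a third of the mass of S. It bounds what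
waiting queue entries lose before their turn. -/
theorem sum_abs_scaledGrad_le_stepOn (hd : ∀ v, 1 ≤ deg G v) {α : ℝ} (hα1 : α < 1) (s : V)
    (y z : V → ℝ) (S W : Finset V) (hSW : Disjoint S W) :
    ∑ v ∈ W, |scaledGrad G α s y z v| ≤
      ∑ v ∈ W, |scaledGrad G α s y (stepOn G α s y z S) v| +
        1 / 3 * ∑ u ∈ S, |scaledGrad G α s y z u| := by
  have h := sum_abs_adjMatrix_mul_le hd S (scaledGrad G α s y z)
  have h1 : ∑ v ∈ W, |∑ u ∈ S, G.adjMatrix ℝ v u * (scaledGrad G α s y z u / deg G u)| ≤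
      ∑ u ∈ S, |scaledGrad G α s y z u| :=
    (sum_le_univ_sum_of_nonneg fun _ => abs_nonneg _).trans h
  calc ∑ v ∈ W, |scaledGrad G α s y z v|
      ≤ ∑ v ∈ W, (|scaledGrad G α s y (stepOn G α s y z S) v| +
          1 / 3 * |∑ u ∈ S, G.adjMatrix ℝ v u * (scaledGrad G α s y z u / deg G u)|) := by
        refine sum_le_sum fun v hv => ?_
        have hv' : v ∉ S := fun h => disjoint_left.1 hSW h hv
        have e := scaledGrad_stepOn hd hα1 s y z S v
        rw [if_neg hv'] at e
        have e' : scaledGrad G α s y z v = scaledGrad G α s y (stepOn G α s y z S) v -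
          1 / 3 * ∑ u ∈ S, G.adjMatrix ℝ v u * (scaledGrad G α s y z u / deg G u) := by
          linarith
        rw [e']
        refine (abs_sub _ _).trans ?_
        rw [abs_mul, abs_of_pos (by norm_num : (0 : ℝ) < 1 / 3)]
    _ ≤ _ := by
        rw [sum_add_distrib, ← mul_sum]
        linarith

/-- Locality: this is why it suffices to reconsider u and its neighbours after an update. -/
theorem scaledGrad_push_of_not_adj (hd : ∀ v, 1 ≤ deg G v) {α : ℝ} (hα1 : α < 1) (s : V)
    (y z : V → ℝ) {u v : V} (hvu : v ≠ u) (hadj : ¬ G.Adj u v) :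
    scaledGrad G α s y (push G α s (1 - 2 * α) y z u) v = scaledGrad G α s y z v := by
  rw [push_eq_stepOn, scaledGrad_stepOn hd hα1]
  have : ¬ G.Adj v u := fun h => hadj h.symm
  simp [hvu, SimpleGraph.adjMatrix_apply, this]

end Step

/-! ### Both solvers as instances of one abstract process -/

section Rounds

variable {V : Type*} [Fintype V] [DecidableEq V] {G : SimpleGraph V} [DecidableRel G.Adj]

/-- The logarithm of the gradient norm, cut off at `e / 3`. -/
def logPot (G : SimpleGraph V) [DecidableRel G.Adj] (α : ℝ) (s : V) (y : V → ℝ) (e : ℝ)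
    (z : V → ℝ) : ℝ :=
  Real.log (max (gradNorm G α s (1 - 2 * α) y z) (e / 3))

/-- What the two local solvers have in common. -/
structure IsLocalRun (G : SimpleGraph V) [DecidableRel G.Adj] (α : ℝ) (s : V) (y : V → ℝ)
    (e : ℝ) (P : ESP V) : Prop where
  z_zero : P.z 0 = y
  roundVol_nonneg : ∀ k, 0 ≤ P.roundVol k
  gradNorm_succ : ∀ k, gradNorm G α s (1 - 2 * α) y (P.z (k + 1)) ≤
    gradNorm G α s (1 - 2 * α) y (P.z k) - 2 / 3 * (e * P.roundVol k)
  logPot_succ : ∀ k, logPot G α s y e (P.z (k + 1)) ≤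
    logPot G α s y e (P.z k) - 2 / 3 * P.roundGamma k
  roundVol_le : ∀ k, P.roundVol k ≤ 8 / 3 * numEdges G * P.roundGamma k
  inactive_of_halted : ∀ k, P.halted k →
    ∀ u, |scaledGrad G α s y (P.z k) u| < e * deg G u
  progress : ∀ k, P.halted k ∨ P.halted (k + 1) ∨ 1 ≤ P.roundVol k

/-- Use log(1 - x) ≤ -x. The cutoff prevents trouble when the new norm is 0, and costs nothing: an
active node forces the old norm N to be at least e, as degrees are at least 1, and the bound N -
(2/3)X is at least N/3 ≥ e/3. -/
theorem logPot_stepOn_le (hd : ∀ v, 1 ≤ deg G v) {α : ℝ} (hα1 : α < 1) (s : V)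
    (y z : V → ℝ) {e : ℝ} (he : 0 < e) (S : Finset V) (hS : S.Nonempty)
    (hact : ∀ u ∈ S, e * deg G u ≤ |scaledGrad G α s y z u|) :
    logPot G α s y e (stepOn G α s y z S) ≤ logPot G α s y e z -
      2 / 3 * ((∑ u ∈ S, |scaledGrad G α s y z u|) / gradNorm G α s (1 - 2 * α) y z) := by
  obtain ⟨u, hu⟩ := hS
  set N := gradNorm G α s (1 - 2 * α) y z with hN
  set X := ∑ u ∈ S, |scaledGrad G α s y z u| with hX
  have h1 := gradNorm_stepOn_le hd hα1 s y z S
  rw [← hN, ← hX] at h1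
  have h2 : e ≤ N := by
    have := abs_scaledGrad_le_gradNorm (G := G) α s y z u
    nlinarith [hact u hu, hd u]
  have hXN : X ≤ N := by
    rw [hN, gradNorm_eq]; exact sum_le_univ_sum_of_nonneg fun _ => abs_nonneg _
  have hNpos : 0 < N := he.trans_le h2
  unfold logPot
  rw [← hN, max_eq_left (by linarith : e / 3 ≤ N)]
  have hfac : 0 < 1 - 2 / 3 * (X / N) := by
    have : X / N ≤ 1 := div_le_one_of_le₀ hXN hNpos.le
    linarith
  have h3 : max (gradNorm G α s (1 - 2 * α) y (stepOn G α s y z S)) (e / 3) ≤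
      N * (1 - 2 / 3 * (X / N)) := by
    have e1 : N * (1 - 2 / 3 * (X / N)) = N - 2 / 3 * X := by field_simp
    rw [e1]
    exact max_le h1 (by linarith)
  calc Real.log (max (gradNorm G α s (1 - 2 * α) y (stepOn G α s y z S)) (e / 3))
      ≤ Real.log (N * (1 - 2 / 3 * (X / N))) :=
        Real.log_le_log (lt_max_of_lt_right (by linarith)) h3
    _ = Real.log N + Real.log (1 - 2 / 3 * (X / N)) := Real.log_mul hNpos.ne' hfac.ne'
    _ ≤ _ := by linarith [Real.log_le_sub_one_of_pos hfac]

theorem vol_nonneg (S : Finset V) : 0 ≤ vol G S :=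
  sum_nonneg fun _ _ => Nat.cast_nonneg _

/-- From e w ≤ X one gets w N ≤ (4w/3 + 2m - w) X = (2m + w/3) X, and w ≤ 2m turns this into 8m/3.
The factor 4/3 is needed only for LocAPPR. -/
theorem vol_le_of_gradNorm_le {N X e w m : ℝ} (hX : e * w ≤ X) (hw : 0 ≤ w) (he : 0 < e)
    (hm : w ≤ 2 * m) (hN : N ≤ 4 / 3 * X + e * (2 * m - w)) (hN0 : 0 < N) :
    w ≤ 8 / 3 * m * (X / N) := by
  rw [← mul_div_assoc, le_div_iff₀ hN0]
  have hX0 : 0 ≤ X := (mul_nonneg he.le hw).trans hX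
  have h1 : w * N ≤ w * (4 / 3 * X + e * (2 * m - w)) := mul_le_mul_of_nonneg_left hN hw
  nlinarith [mul_nonneg (sub_nonneg.2 hm) (sub_nonneg.2 hX), mul_nonneg (sub_nonneg.2 hm) hX0]

theorem vol_le_two_mul_numEdges (S : Finset V) : vol G S ≤ 2 * numEdges G := by
  rw [← sum_deg]
  exact sum_le_univ_sum_of_nonneg fun _ => Nat.cast_nonneg _

theorem sum_abs_scaledGrad_compl_le (α : ℝ) (s : V) (y z : V → ℝ) (e : ℝ) (S : Finset V)
    (h : ∀ u ∉ S, |scaledGrad G α s y z u| < e * deg G u) :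
    gradNorm G α s (1 - 2 * α) y z ≤ ∑ u ∈ S, |scaledGrad G α s y z u| +
      e * (2 * numEdges G - vol G S) := by
  rw [gradNorm_eq, ← sum_add_sum_compl S, ← sum_deg, ← sum_add_sum_compl S (deg G ·)]
  unfold vol
  rw [add_sub_cancel_left, mul_sum]
  have := sum_le_sum (s := Sᶜ) fun u hu => (h u (mem_compl.1 hu)).le
  linarith

theorem mem_activeSet (hd : ∀ v, 1 ≤ deg G v) (α : ℝ) (s : V) (y : V → ℝ) (e : ℝ) (z : V → ℝ)
    (u : V) : u ∈ activeSet G α s (1 - 2 * α) y e z ↔ e * deg G u ≤ |scaledGrad G α s y z u| := by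
  simp only [activeSet, mem_filter, mem_univ, true_and, active_iff hd]

theorem stepOn_empty (α : ℝ) (s : V) (y z : V → ℝ) : stepOn G α s y z ∅ = z := by
  funext u; simp [stepOn]

theorem mul_vol_le (α : ℝ) (s : V) (y z : V → ℝ) {e : ℝ} (S : Finset V)
    (hact : ∀ u ∈ S, e * deg G u ≤ |scaledGrad G α s y z u|) :
    e * vol G S ≤ ∑ u ∈ S, |scaledGrad G α s y z u| := by
  unfold vol
  rw [mul_sum]
  exact sum_le_sum hact

theorem locGD_isLocalRun (hd : ∀ v, 1 ≤ deg G v) {α : ℝ} (hα1 : α < 1) (s : V)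
    (φ : ℝ) (y : V → ℝ) (he : 0 < innerTol G α s (1 - 2 * α) φ y) :
    IsLocalRun G α s y (innerTol G α s (1 - 2 * α) φ y) (locGD G α s (1 - 2 * α) φ y) := by
  set e := innerTol G α s (1 - 2 * α) φ y with hedef
  set P := locGD G α s (1 - 2 * α) φ y with hP
  set S : ℕ → Finset V := fun k => activeSet G α s (1 - 2 * α) y e (P.z k) with hS
  have hact : ∀ k, ∀ u ∈ S k, e * deg G u ≤ |scaledGrad G α s y (P.z k) u| := fun k u hu =>
    (mem_activeSet hd α s y e _ u).1 hu
  have hinact : ∀ k, ∀ u ∉ S k, |scaledGrad G α s y (P.z k) u| < e * deg G u := fun k u hu =>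
    not_le.1 fun h => hu ((mem_activeSet hd α s y e _ u).2 h)
  have hz : ∀ k, P.z (k + 1) = stepOn G α s y (P.z k) (S k) := fun k => by
    change (locGDStep G α s (1 - 2 * α) y e)^[k + 1] y = _
    rw [Function.iterate_succ_apply', locGDStep_eq_stepOn]; rfl
  have hvol : ∀ k, P.roundVol k = vol G (S k) := fun _ => rfl
  have hgam : ∀ k, P.roundGamma k = (∑ u ∈ S k, |scaledGrad G α s y (P.z k) u|) /
    gradNorm G α s (1 - 2 * α) y (P.z k) := fun _ => rfl
  have hhalt : ∀ k, P.halted k ↔ S k = ∅ := fun _ => Iff.rfl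
  refine ⟨rfl, fun k => vol_nonneg _, fun k => ?_, fun k => ?_, fun k => ?_, fun k hk u => ?_,
    fun k => ?_⟩
  · rw [hz, hvol]
    have := gradNorm_stepOn_le hd hα1 s y (P.z k) (S k)
    have := mul_vol_le α s y (P.z k) (S k) (hact k)
    linarith
  · rw [hgam, hz]
    rcases (S k).eq_empty_or_nonempty with h | h
    -- Rounds after the halt leave the point fixed and have γ = 0.
    · rw [h, stepOn_empty]; simp
    · exact logPot_stepOn_le hd hα1 s y _ he _ h (hact k)
  · rw [hvol, hgam]
    rcases (S k).eq_empty_or_nonempty with h | ⟨u, hu⟩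
    · rw [h]; simp [vol]
    · have h1 := mul_vol_le α s y (P.z k) (S k) (hact k)
      have h2 := sum_abs_scaledGrad_compl_le α s y (P.z k) e (S k) (hinact k)
      refine vol_le_of_gradNorm_le h1 (vol_nonneg _) he (vol_le_two_mul_numEdges _) ?_ ?_
      · have : 0 ≤ ∑ u ∈ S k, |scaledGrad G α s y (P.z k) u| := sum_nonneg fun _ _ => abs_nonneg _
        linarith
      · have := abs_scaledGrad_le_gradNorm (G := G) α s y (P.z k) u
        nlinarith [hact k u hu, hd u]
  · refine hinact k u ?_
    rw [(hhalt k).1 hk]; simp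
  · rcases (S k).eq_empty_or_nonempty with h | ⟨u, hu⟩
    · exact Or.inl ((hhalt k).2 h)
    · refine Or.inr (Or.inr ?_)
      rw [hvol]
      exact (hd u).trans (single_le_sum (f := fun v => deg G v)
        (fun v _ => by linarith [hd v]) hu)

/-! ### The queue of LocAPPR -/

theorem mem_enqueue_of_mem (α : ℝ) (s : V) (η : ℝ) (y : V → ℝ) (e : ℝ) (z : V → ℝ)
    (rest cs next : List V) {v : V} (hv : v ∈ next) :
    v ∈ enqueue G α s η y e z rest cs next := by
  induction cs generalizing next with
  | nil => exact hv
  | cons c cs ih =>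
    unfold enqueue
    split_ifs
    · exact ih _ (List.mem_append_left _ hv)
    · exact ih _ hv

theorem mem_enqueue_of_active (α : ℝ) (s : V) (η : ℝ) (y : V → ℝ) (e : ℝ) (z : V → ℝ)
    (rest cs next : List V) {v : V} (hv : v ∈ cs) (hact : Active G α s η y e z v)
    (hrest : v ∉ rest) : v ∈ enqueue G α s η y e z rest cs next := by
  induction cs generalizing next with
  | nil => simp at hv
  | cons c cs ih =>
    unfold enqueue
    rcases List.mem_cons.1 hv with rfl | hv
    · split_ifs with h
      · exact mem_enqueue_of_mem _ _ _ _ _ _ _ _ _ (by simp)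
      · refine mem_enqueue_of_mem _ _ _ _ _ _ _ _ _ ?_
        by_contra hn
        exact h ⟨hact, hrest, hn⟩
    · split_ifs
      · exact ih _ hv
      · exact ih _ hv

theorem nodup_enqueue (α : ℝ) (s : V) (η : ℝ) (y : V → ℝ) (e : ℝ) (z : V → ℝ)
    (rest cs next : List V) (h : next.Nodup) : (enqueue G α s η y e z rest cs next).Nodup := by
  induction cs generalizing next with
  | nil => exact h
  | cons c cs ih =>
    unfold enqueue
    split_ifs with hc
    · refine ih _ (List.Nodup.append h (by simp) ?_)
      simpa using hc.2.2
    · exact ih _ h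

theorem apprRound_nodup (L : AdjLists G) (α : ℝ) (s : V) (η : ℝ) (y : V → ℝ) (e : ℝ)
    (l : List V) (z : V → ℝ) (next : List V) (h : next.Nodup) :
    (apprRound G L α s η y e l z next).2.1.Nodup := by
  induction l generalizing z next with
  | nil => exact h
  | cons u rest ih =>
    unfold apprRound
    split_ifs with hu
    · exact ih _ _ (nodup_enqueue _ _ _ _ _ _ _ _ _ h)
    · exact ih _ _ h

/-- The queue invariant: a node outside the queue can become active only through an update of itself
or of a neighbour, and exactly these nodes are tested for insertion. -/
theorem apprRound_active_mem (hd : ∀ v, 1 ≤ deg G v) (L : AdjLists G) {α : ℝ} (hα1 : α < 1)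
    (s : V) (y : V → ℝ) (e : ℝ) (l : List V) (z : V → ℝ) (next : List V)
    (h : ∀ v, Active G α s (1 - 2 * α) y e z v → v ∈ l ∨ v ∈ next) (v : V)
    (hv : Active G α s (1 - 2 * α) y e (apprRound G L α s (1 - 2 * α) y e l z next).1 v) :
    v ∈ (apprRound G L α s (1 - 2 * α) y e l z next).2.1 := by
  induction l generalizing z next with
  | nil => exact (h v hv).resolve_left (by simp)
  | cons u rest ih =>
    unfold apprRound at hv ⊢
    split_ifs at hv ⊢ with hu
    · refine ih _ _ (fun w hw => ?_) hv
      by_cases hr : w ∈ rest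
      · exact Or.inl hr
      refine Or.inr ?_
      by_cases hc : w ∈ L.nbrs u ++ [u]
      · exact mem_enqueue_of_active _ _ _ _ _ _ _ _ _ hc hw hr
      · have hc' : ¬ G.Adj u w ∧ w ≠ u := by
          simpa [L.mem_nbrs] using hc
        rw [active_iff hd, scaledGrad_push_of_not_adj hd hα1 s y z hc'.2 hc'.1,
          ← active_iff hd] at hw
        rcases h w hw with h1 | h1
        · rcases List.mem_cons.1 h1 with h2 | h2
          · exact absurd h2 hc'.2
          · exact absurd h2 hr
        · exact mem_enqueue_of_mem _ _ _ _ _ _ _ _ _ h1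
    · refine ih _ _ (fun w hw => ?_) hv
      rcases h w hw with h1 | h1
      · rcases List.mem_cons.1 h1 with rfl | h2
        · exact absurd hw hu
        · exact Or.inl h2
      · exact Or.inr h1

/-- The volume of the nodes that are updated in a round of LocAPPR. -/
def doneVol (G : SimpleGraph V) [DecidableRel G.Adj] (d : List (V × ℝ)) : ℝ :=
  (d.map fun w => deg G w.1).sum

/-- The sum of the active ratios of a round of LocAPPR. -/
def doneGamma (d : List (V × ℝ)) : ℝ := (d.map fun w => w.2).sum

theorem doneVol_nonneg (d : List (V × ℝ)) : 0 ≤ doneVol G d :=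
  List.sum_nonneg fun x hx => by
    obtain ⟨w, _, rfl⟩ := List.mem_map.1 hx
    exact Nat.cast_nonneg _

theorem doneVol_apprRound_le (L : AdjLists G) (α : ℝ) (s : V) (η : ℝ) (y : V → ℝ) (e : ℝ)
    (l : List V) (z : V → ℝ) (next : List V) :
    doneVol G (apprRound G L α s η y e l z next).2.2 ≤ (l.map (deg G)).sum := by
  induction l generalizing z next with
  | nil => simp [apprRound, doneVol]
  | cons u rest ih =>
    unfold apprRound
    have hu0 : 0 ≤ deg G u := Nat.cast_nonneg _
    split_ifs with hu
    · simp only [doneVol, List.map_cons, List.sum_cons]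
      have := ih (push G α s η y z u) (enqueue G α s η y e (push G α s η y z u) rest
        (L.nbrs u ++ [u]) next)
      unfold doneVol at this
      linarith
    · simp only [List.map_cons, List.sum_cons]
      linarith [ih z next]

theorem apprRound_next_of_done_nil (L : AdjLists G) (α : ℝ) (s : V) (η : ℝ) (y : V → ℝ) (e : ℝ)
    (l : List V) (z : V → ℝ) (next : List V)
    (h : (apprRound G L α s η y e l z next).2.2 = []) :
    (apprRound G L α s η y e l z next).2.1 = next := by
  induction l generalizing z next with
  | nil => rfl
  | cons u rest ih =>
    unfold apprRound at h ⊢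
    split_ifs at h ⊢ with hu
    · exact ih _ _ h

theorem apprRound_gradNorm_le (hd : ∀ v, 1 ≤ deg G v) (L : AdjLists G) {α : ℝ} (hα1 : α < 1)
    (s : V) (y : V → ℝ) (e : ℝ) (l : List V) (z : V → ℝ) (next : List V) :
    gradNorm G α s (1 - 2 * α) y (apprRound G L α s (1 - 2 * α) y e l z next).1 ≤
      gradNorm G α s (1 - 2 * α) y z -
        2 / 3 * (e * doneVol G (apprRound G L α s (1 - 2 * α) y e l z next).2.2) := by
  induction l generalizing z next with
  | nil => simp [apprRound, doneVol]
  | cons u rest ih =>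
    unfold apprRound
    split_ifs with hu
    · simp only [doneVol, List.map_cons, List.sum_cons]
      have h1 := ih (push G α s (1 - 2 * α) y z u)
        (enqueue G α s (1 - 2 * α) y e (push G α s (1 - 2 * α) y z u) rest
          (L.nbrs u ++ [u]) next)
      have h2 := gradNorm_stepOn_le hd hα1 s y z {u}
      rw [← push_eq_stepOn, sum_singleton] at h2
      rw [active_iff hd] at hu
      unfold doneVol at h1
      linarith
    · exact ih z next

theorem apprRound_logPot_le (hd : ∀ v, 1 ≤ deg G v) (L : AdjLists G) {α : ℝ} (hα1 : α < 1)
    (s : V) (y : V → ℝ) {e : ℝ} (he : 0 < e) (l : List V) (z : V → ℝ) (next : List V) :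
    logPot G α s y e (apprRound G L α s (1 - 2 * α) y e l z next).1 ≤
      logPot G α s y e z -
        2 / 3 * doneGamma (apprRound G L α s (1 - 2 * α) y e l z next).2.2 := by
  induction l generalizing z next with
  | nil => simp [apprRound, doneGamma]
  | cons u rest ih =>
    unfold apprRound
    split_ifs with hu
    · simp only [doneGamma, List.map_cons, List.sum_cons]
      have h1 := ih (push G α s (1 - 2 * α) y z u)
        (enqueue G α s (1 - 2 * α) y e (push G α s (1 - 2 * α) y z u) rest
          (L.nbrs u ++ [u]) next)
      rw [active_iff hd] at hu
      have h2 := logPot_stepOn_le hd hα1 s y z he {u} ⟨u, mem_singleton_self u⟩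
        (fun v hv => by rw [mem_singleton.1 hv]; exact hu)
      rw [← push_eq_stepOn, sum_singleton] at h2
      unfold doneGamma at h1
      unfold scaledGrad at h2
      linarith
    · exact ih z next

/-- The mass of a queue is bounded by the mass that the pushes of a round find. -/
theorem apprRound_queue_mass (hd : ∀ v, 1 ≤ deg G v) (L : AdjLists G) {α : ℝ} (hα1 : α < 1)
    (s : V) (y : V → ℝ) {e N : ℝ} (he : 0 < e) (l : List V) (hl : l.Nodup) (z : V → ℝ)
    (next : List V) (hN : gradNorm G α s (1 - 2 * α) y z ≤ N) :
    ∃ X : ℝ, e * doneVol G (apprRound G L α s (1 - 2 * α) y e l z next).2.2 ≤ X ∧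
      X / N ≤ doneGamma (apprRound G L α s (1 - 2 * α) y e l z next).2.2 ∧
      (l.map fun v => |scaledGrad G α s y z v|).sum ≤ 4 / 3 * X +
        e * ((l.map (deg G)).sum -
          doneVol G (apprRound G L α s (1 - 2 * α) y e l z next).2.2) := by
  induction l generalizing z next with
  | nil => exact ⟨0, by simp [apprRound, doneVol, doneGamma]⟩
  | cons u rest ih =>
    have hu' : u ∉ rest := (List.nodup_cons.1 hl).1
    unfold apprRound
    split_ifs with hu
    · have h2 := gradNorm_stepOn_le hd hα1 s y z {u}
      rw [← push_eq_stepOn, sum_singleton] at h2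
      rw [active_iff hd] at hu
      obtain ⟨X, hX1, hX2, hX3⟩ := ih (List.nodup_cons.1 hl).2 (push G α s (1 - 2 * α) y z u)
        (enqueue G α s (1 - 2 * α) y e (push G α s (1 - 2 * α) y z u) rest
          (L.nbrs u ++ [u]) next) (by linarith [abs_nonneg (scaledGrad G α s y z u)])
      refine ⟨X + |scaledGrad G α s y z u|, ?_, ?_, ?_⟩
      · simp only [doneVol, List.map_cons, List.sum_cons]
        unfold doneVol at hX1
        linarith
      · simp only [doneGamma, List.map_cons, List.sum_cons]
        unfold doneGamma at hX2
        have hpos : 0 < gradNorm G α s (1 - 2 * α) y z := by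
          have := abs_scaledGrad_le_gradNorm (G := G) α s y z u
          nlinarith [hd u]
        -- The norm only decreases within a round, so measuring against the starting norm N
        -- underestimates the recorded ratio.
        have h3 : |scaledGrad G α s y z u| / N ≤
            |scaledGrad G α s y z u| / gradNorm G α s (1 - 2 * α) y z :=
          div_le_div_of_nonneg_left (abs_nonneg _) hpos hN
        rw [add_div]
        unfold scaledGrad at h3 ⊢
        linarith
      · simp only [doneVol, List.map_cons, List.sum_cons]
        unfold doneVol at hX3
        -- Besides its own mass, the push of u is charged with the third of it that may be lost from
        -- the rest of the queue; hence 4/3.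
        have h3 := sum_abs_scaledGrad_le_stepOn hd hα1 s y z {u} rest.toFinset (by simpa using hu')
        rw [← push_eq_stepOn, sum_singleton,
          List.sum_toFinset _ (List.nodup_cons.1 hl).2,
          List.sum_toFinset _ (List.nodup_cons.1 hl).2] at h3
        linarith
    · obtain ⟨X, hX1, hX2, hX3⟩ := ih (List.nodup_cons.1 hl).2 z next hN
      refine ⟨X, hX1, hX2, ?_⟩
      rw [active_iff hd, not_le] at hu
      simp only [List.map_cons, List.sum_cons]
      linarith

theorem apprRound_vol_le (hd : ∀ v, 1 ≤ deg G v) (L : AdjLists G) {α : ℝ} (hα1 : α < 1)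
    (s : V) (y : V → ℝ) {e : ℝ} (he : 0 < e) (l : List V) (hl : l.Nodup) (z : V → ℝ)
    (h : ∀ v, Active G α s (1 - 2 * α) y e z v → v ∈ l) :
    doneVol G (apprRound G L α s (1 - 2 * α) y e l z []).2.2 ≤ 8 / 3 * numEdges G *
      doneGamma (apprRound G L α s (1 - 2 * α) y e l z []).2.2 := by
  obtain ⟨X, hX1, hX2, hX3⟩ := apprRound_queue_mass hd L hα1 s y he l hl z [] le_rfl
  have hm : 0 ≤ numEdges G := Nat.cast_nonneg _
  rcases (gradNorm_nonneg (G := G) α s (1 - 2 * α) y z).eq_or_lt with h0 | h0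
  -- With norm 0 the quotient X / 0 = 0 says nothing, but the norm cannot fall any further, so no
  -- volume was processed.
  · have h1 := apprRound_gradNorm_le hd L hα1 s y e l z []
    have h2 := gradNorm_nonneg (G := G) α s (1 - 2 * α) y
      (apprRound G L α s (1 - 2 * α) y e l z []).1
    rw [← h0, div_zero] at hX2
    have : doneVol G (apprRound G L α s (1 - 2 * α) y e l z []).2.2 ≤ 0 := by
      by_contra hc
      have := mul_pos he (not_le.1 hc)
      linarith
    exact this.trans (by positivity)
  · have h1 := sum_abs_scaledGrad_compl_le α s y z e l.toFinset (fun u hu => by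
      by_contra hc
      exact hu (List.mem_toFinset.2 (h u ((active_iff hd α s y e z u).2 (not_lt.1 hc)))))
    have hv : vol G l.toFinset = (l.map (deg G)).sum := List.sum_toFinset _ hl
    rw [List.sum_toFinset _ hl, hv] at h1
    refine (vol_le_of_gradNorm_le hX1 (doneVol_nonneg _) he ?_ ?_ h0).trans
      (mul_le_mul_of_nonneg_left hX2 (by positivity))
    · refine (doneVol_apprRound_le L α s _ y e l z []).trans ?_
      rw [← hv]
      exact vol_le_two_mul_numEdges _
    · linarith

theorem locAPPR_isLocalRun (hd : ∀ v, 1 ≤ deg G v) (L : AdjLists G) {α : ℝ} (hα1 : α < 1)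
    (s : V) (φ : ℝ) (y : V → ℝ) (he : 0 < innerTol G α s (1 - 2 * α) φ y) :
    IsLocalRun G α s y (innerTol G α s (1 - 2 * α) φ y) (locAPPR G L α s (1 - 2 * α) φ y) := by
  set e := innerTol G α s (1 - 2 * α) φ y with hedef
  set st := apprState G L α s (1 - 2 * α) y e with hst
  have hst' : ∀ k, st (k + 1) =
    ((apprRound G L α s (1 - 2 * α) y e (st k).2 (st k).1 []).1,
      (apprRound G L α s (1 - 2 * α) y e (st k).2 (st k).1 []).2.1) := fun _ => rfl
  have hinv : ∀ k, (st k).2.Nodup ∧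
      ∀ v, Active G α s (1 - 2 * α) y e (st k).1 v → v ∈ (st k).2 := by
    intro k
    induction k with
    | zero =>
      refine ⟨L.nodes_nodup.filter _, fun v hv => ?_⟩
      refine List.mem_filter.2 ⟨L.mem_nodes v, ?_⟩
      simp only [decide_eq_true_eq]
      exact hv
    | succ k ih =>
      rw [hst']
      exact ⟨apprRound_nodup L α s _ y e _ _ _ List.nodup_nil, fun v hv =>
        apprRound_active_mem hd L hα1 s y e _ _ [] (fun w hw => Or.inl (ih.2 w hw)) v hv⟩
  refine ⟨rfl, fun k => doneVol_nonneg _, fun k => ?_, fun k => ?_, fun k => ?_, fun k hk u => ?_,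
    fun k => ?_⟩
  · exact apprRound_gradNorm_le hd L hα1 s y e (st k).2 (st k).1 []
  · exact apprRound_logPot_le hd L hα1 s y he (st k).2 (st k).1 []
  · exact apprRound_vol_le hd L hα1 s y he (st k).2 (hinv k).1 (st k).1 (hinv k).2
  · by_contra hc
    have h1 := (hinv k).2 u ((active_iff hd α s y e _ u).2 (not_lt.1 hc))
    have hk' : (st k).2 = [] := hk
    rw [hk'] at h1
    simp at h1
  · rcases hdone : (apprRound G L α s (1 - 2 * α) y e (st k).2 (st k).1 []).2.2 with _ | ⟨w, d⟩
    -- A round may skip every node of its queue. It then inserts nothing, and the solver halts one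
    -- round later.
    · exact Or.inr (Or.inl (apprRound_next_of_done_nil L α s _ y e _ _ [] hdone))
    · refine Or.inr (Or.inr ?_)
      change 1 ≤ doneVol G (apprRound G L α s (1 - 2 * α) y e (st k).2 (st k).1 []).2.2
      rw [hdone]
      have := doneVol_nonneg (G := G) d
      have hw := hd w.1
      unfold doneVol at this ⊢
      simp only [List.map_cons, List.sum_cons]
      linarith

theorem isLocalRun_call (hd : ∀ v, 1 ≤ deg G v) (M : LocalSolver) (L : AdjLists G) {α : ℝ}
    (hα1 : α < 1) (s : V) (φ : ℝ) (y : V → ℝ) (he : 0 < innerTol G α s (1 - 2 * α) φ y) :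
    IsLocalRun G α s y (innerTol G α s (1 - 2 * α) φ y) (M.call L α s (1 - 2 * α) φ y) := by
  cases M
  · exact locGD_isLocalRun hd hα1 s φ y he
  · exact locAPPR_isLocalRun hd L hα1 s φ y he

end Rounds

/-! ### Termination, cost and accuracy of one call -/

section Call

variable {V : Type*} [Fintype V] [DecidableEq V] {G : SimpleGraph V} [DecidableRel G.Adj]

theorem ESP.work_eq (P : ESP V) : P.work = ∑ k ∈ range P.rounds, P.roundVol k := by
  unfold ESP.work ESP.avgVol
  rcases Nat.eq_zero_or_pos P.rounds with h | h
  · simp [h]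
  · have : (P.rounds : ℝ) ≠ 0 := by positivity
    field_simp

theorem ESP.avgVol_div_avgGamma (P : ESP V) : P.avgVol / P.avgGamma =
    (∑ k ∈ range P.rounds, P.roundVol k) / ∑ k ∈ range P.rounds, P.roundGamma k := by
  unfold ESP.avgVol ESP.avgGamma
  rcases Nat.eq_zero_or_pos P.rounds with h | h
  · simp [h]
  · have : (P.rounds : ℝ) ≠ 0 := by positivity
    rw [mul_div_mul_left]
    positivity

namespace IsLocalRun

variable {α : ℝ} {s : V} {y : V → ℝ} {e : ℝ} {P : ESP V}

theorem mul_sum_roundVol_le (h : IsLocalRun G α s y e P) (K : ℕ) :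
    2 / 3 * (e * ∑ k ∈ range K, P.roundVol k) ≤
      gradNorm G α s (1 - 2 * α) y y - gradNorm G α s (1 - 2 * α) y (P.z K) := by
  induction K with
  | zero => simp [h.z_zero]
  | succ K ih =>
    rw [sum_range_succ]
    linarith [h.gradNorm_succ K]

theorem sum_roundGamma_le (h : IsLocalRun G α s y e P) (K : ℕ) :
    2 / 3 * ∑ k ∈ range K, P.roundGamma k ≤ logPot G α s y e y - logPot G α s y e (P.z K) := by
  induction K with
  | zero => simp [h.z_zero]
  | succ K ih =>
    rw [sum_range_succ]
    linarith [h.logPot_succ K]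

/-- As long as the process goes on, each round has volume at least 1 and lowers the nonnegative
gradient norm by at least 2e/3. -/
theorem exists_halted (h : IsLocalRun G α s y e P) (he : 0 < e) : ∃ k, P.halted k := by
  by_contra! hn
  have h1 : ∀ k, 1 ≤ P.roundVol k := fun k =>
    ((h.progress k).resolve_left (hn k)).resolve_left (hn (k + 1))
  obtain ⟨K, hK⟩ := exists_nat_gt (gradNorm G α s (1 - 2 * α) y y / (2 / 3 * e))
  rw [div_lt_iff₀ (by positivity)] at hK
  have h2 := h.mul_sum_roundVol_le K
  have h3 : (K : ℝ) ≤ ∑ k ∈ range K, P.roundVol k := by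
    have := card_nsmul_le_sum (range K) P.roundVol 1 fun k _ => h1 k
    simpa using this
  have h4 := gradNorm_nonneg (G := G) α s (1 - 2 * α) y (P.z K)
  nlinarith

theorem halted_rounds (h : IsLocalRun G α s y e P) (he : 0 < e) : P.halted P.rounds :=
  Nat.sInf_mem (h.exists_halted he)

theorem work_le (h : IsLocalRun G α s y e P) (he : 0 < e) :
    P.work ≤ 3 / 2 * (gradNorm G α s (1 - 2 * α) y y / e) := by
  have h1 := h.mul_sum_roundVol_le P.rounds
  have h2 := gradNorm_nonneg (G := G) α s (1 - 2 * α) y (P.z P.rounds)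
  rw [P.work_eq, ← mul_div_assoc, le_div_iff₀ he]
  linarith

theorem sum_roundVol_le (h : IsLocalRun G α s y e P) (K : ℕ) :
    ∑ k ∈ range K, P.roundVol k ≤ 8 / 3 * numEdges G * ∑ k ∈ range K, P.roundGamma k := by
  rw [mul_sum]; exact sum_le_sum fun k _ => h.roundVol_le k

theorem sum_roundGamma_nonneg (h : IsLocalRun G α s y e P) (hm : 0 < numEdges G) (K : ℕ) :
    0 ≤ ∑ k ∈ range K, P.roundGamma k := by
  refine sum_nonneg fun k _ => ?_
  have := (h.roundVol_nonneg k).trans (h.roundVol_le k)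
  exact nonneg_of_mul_nonneg_right this (by positivity)

theorem ratio_nonneg (h : IsLocalRun G α s y e P) (hm : 0 < numEdges G) :
    0 ≤ P.avgVol / P.avgGamma := by
  rw [P.avgVol_div_avgGamma]
  exact div_nonneg (sum_nonneg fun k _ => h.roundVol_nonneg k) (h.sum_roundGamma_nonneg hm _)

theorem ratio_le (h : IsLocalRun G α s y e P) (hm : 0 < numEdges G) :
    P.avgVol / P.avgGamma ≤ 8 / 3 * numEdges G := by
  rw [P.avgVol_div_avgGamma]
  exact div_le_of_le_mul₀ (h.sum_roundGamma_nonneg hm _) (by positivity) (h.sum_roundVol_le _)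

/-- The sum of the γ is paid for by the fall of `logPot`, which cannot go below log(e/3). -/
theorem work_le_ratio (h : IsLocalRun G α s y e P) (he : 0 < e) (hm : 0 < numEdges G) :
    P.work ≤ P.avgVol / P.avgGamma *
      (3 / 2 * Real.log (max (3 * gradNorm G α s (1 - 2 * α) y y / e) 1)) := by
  have h0 := h.sum_roundGamma_nonneg hm P.rounds
  have h1 := h.sum_roundGamma_le P.rounds
  have h2 := h.sum_roundVol_le P.rounds
  have h3 : logPot G α s y e y - logPot G α s y e (P.z P.rounds) ≤
      Real.log (max (3 * gradNorm G α s (1 - 2 * α) y y / e) 1) := by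
    have e1 : max (gradNorm G α s (1 - 2 * α) y y) (e / 3) =
        e / 3 * max (3 * gradNorm G α s (1 - 2 * α) y y / e) 1 := by
      rw [mul_max_of_nonneg _ _ (by positivity)]
      congr 1
      · field_simp
      · ring
    have e2 : Real.log (e / 3) ≤ logPot G α s y e (P.z P.rounds) :=
      Real.log_le_log (by positivity) (le_max_right _ _)
    unfold logPot at e2 ⊢
    rw [e1, Real.log_mul (by positivity) (lt_max_of_lt_right one_pos).ne']
    linarith
  have hr := h.ratio_nonneg hm
  rw [P.avgVol_div_avgGamma] at hr ⊢
  rw [P.work_eq]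
  have h4 : ∑ k ∈ range P.rounds, P.roundVol k = (∑ k ∈ range P.rounds, P.roundVol k) /
      (∑ k ∈ range P.rounds, P.roundGamma k) * ∑ k ∈ range P.rounds, P.roundGamma k := by
    -- If the γ sum to 0, the volumes do too by `sum_roundVol_le`, so the default value of 0 / 0 is
    -- harmless.
    rcases h0.eq_or_lt with hz | hp
    · rw [← hz] at h2 ⊢
      have := sum_nonneg (s := range P.rounds) fun k _ => h.roundVol_nonneg k
      simp only [mul_zero] at h2 ⊢
      linarith
    · field_simp
  refine h4.trans_le (mul_le_mul_of_nonneg_left ?_ hr)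
  linarith

theorem abs_gradH_output_le (h : IsLocalRun G α s y e P) (hd : ∀ v, 1 ≤ deg G v) (he : 0 < e)
    (u : V) : |gradH G α s (1 - 2 * α) y P.output u| ≤ e * √(deg G u) := by
  have h1 := (h.inactive_of_halted _ (h.halted_rounds he) u).not_ge
  rw [← active_iff hd] at h1
  exact (not_le.1 h1).le

end IsLocalRun

theorem innerTol_eq (α : ℝ) (s : V) (φ : ℝ) (y : V → ℝ) :
    innerTol G α s (1 - 2 * α) φ y = max √((1 - α) * φ / numEdges G)
      (2 * (1 - α) * φ / gradNorm G α s (1 - 2 * α) y y) := by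
  unfold innerTol
  rw [show α + (1 - 2 * α) = 1 - α by ring, show 1 - 2 * α + α = 1 - α by ring]

theorem innerTol_pos {α : ℝ} (hα1 : α < 1) (s : V) {φ : ℝ} (hφ : 0 < φ) (hm : 0 < numEdges G)
    (y : V → ℝ) : 0 < innerTol G α s (1 - 2 * α) φ y := by
  rw [innerTol_eq]
  -- The first entry keeps the tolerance positive even if the initial gradient vanishes and the
  -- second entry is 0 by division by zero.
  exact lt_max_of_lt_left (Real.sqrt_pos.2 (div_pos (mul_pos (by linarith) hφ) hm))

theorem le_innerTol_sq {α : ℝ} (hα1 : α < 1) (s : V) {φ : ℝ} (hφ : 0 < φ)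
    (hm : 0 < numEdges G) (y : V → ℝ) :
    (1 - α) * φ / numEdges G ≤ innerTol G α s (1 - 2 * α) φ y ^ 2 := by
  have h : 0 ≤ (1 - α) * φ / numEdges G :=
    div_nonneg (mul_nonneg (by linarith) hφ.le) hm.le
  rw [innerTol_eq]
  refine (Real.sq_sqrt h).symm.trans_le ?_
  exact pow_le_pow_left₀ (Real.sqrt_nonneg _) (le_max_left _ _) 2

/-- The stopping rule of the local solver guarantees the accuracy `φ`. -/
theorem sum_sq_gradH_output_le (hd : ∀ v, 1 ≤ deg G v) (hm : 0 < numEdges G) (M : LocalSolver)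
    (L : AdjLists G) {α : ℝ} (hα1 : α < 1) (s : V) {φ : ℝ} (hφ : 0 < φ) (y : V → ℝ) :
    ∑ u, gradH G α s (1 - 2 * α) y (M.call L α s (1 - 2 * α) φ y).output u ^ 2 ≤
      2 * (1 - α) * φ := by
  have he := innerTol_pos hα1 s hφ hm y
  have hrun := isLocalRun_call hd M L hα1 s φ y he
  set e := innerTol G α s (1 - 2 * α) φ y with hedef
  set P := M.call L α s (1 - 2 * α) φ y
  have hout := hrun.abs_gradH_output_le hd he
  set g := gradH G α s (1 - 2 * α) y P.output with hg
  rw [innerTol_eq] at hedef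
  -- If the square root is the maximum, sum g_u² ≤ e² d_u with Σ d_u = 2m. If the quotient is, use Σ
  -- g_u² ≤ e ‖D^{1/2}g‖₁ and the fact that this norm has not grown since the start.
  rcases max_choice (√((1 - α) * φ / numEdges G))
    (2 * (1 - α) * φ / gradNorm G α s (1 - 2 * α) y y) with hc | hc
  · have he2 : e ^ 2 = (1 - α) * φ / numEdges G := by
      rw [hedef, hc, Real.sq_sqrt]
      exact div_nonneg (mul_nonneg (by linarith) hφ.le) hm.le
    calc ∑ u, g u ^ 2 ≤ ∑ u, e ^ 2 * deg G u := by
          refine sum_le_sum fun u _ => ?_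
          rw [← sq_abs, ← Real.sq_sqrt (by linarith [hd u] : 0 ≤ deg G u), ← mul_pow]
          exact pow_le_pow_left₀ (abs_nonneg _) (hout u) 2
      _ = 2 * (1 - α) * φ := by
          rw [← mul_sum, sum_deg, he2]; field_simp
  · have he2 : e * gradNorm G α s (1 - 2 * α) y y = 2 * (1 - α) * φ := by
      have h1 : e = 2 * (1 - α) * φ / gradNorm G α s (1 - 2 * α) y y := by rw [hedef, hc]
      have h2 : gradNorm G α s (1 - 2 * α) y y ≠ 0 := fun h0 => by
        rw [h0, div_zero] at h1; exact he.ne' h1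
      rw [h1, div_mul_cancel₀ _ h2]
    have hdec : gradNorm G α s (1 - 2 * α) y P.output ≤ gradNorm G α s (1 - 2 * α) y y := by
      have h1 := hrun.mul_sum_roundVol_le P.rounds
      have h2 : 0 ≤ ∑ k ∈ range P.rounds, P.roundVol k :=
        sum_nonneg fun k _ => hrun.roundVol_nonneg k
      have h3 : 0 ≤ e * ∑ k ∈ range P.rounds, P.roundVol k := mul_nonneg he.le h2
      unfold ESP.output
      linarith
    calc ∑ u, g u ^ 2 ≤ ∑ u, e * |√(deg G u) * g u| := by
          refine sum_le_sum fun u _ => ?_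
          rw [← sq_abs, abs_mul, abs_of_nonneg (Real.sqrt_nonneg _), ← mul_assoc, sq]
          exact mul_le_mul_of_nonneg_right (hout u) (abs_nonneg _)
      _ = e * gradNorm G α s (1 - 2 * α) y P.output := (mul_sum _ _ _).symm
      _ ≤ _ := by
          rw [← he2]
          exact mul_le_mul_of_nonneg_left hdec he.le

end Call

/-! ### Inexact accelerated proximal point step -/

section Acceleration

variable {V : Type*} [Fintype V] [DecidableEq V] {G : SimpleGraph V} [DecidableRel G.Adj]

/-- The coordinatewise inequality behind the accelerated proximal point method. -/
theorem accelerated_pointwise {a μ κ g N X W v Y : ℝ} (ha : a < 1) (hμ : 0 ≤ μ) (ha0 : 0 ≤ a)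
    (hκ : κ * a ^ 2 = μ * (1 - a ^ 2)) (hW : a * W = N - (1 - a) * X)
    (hY : (1 + a) * Y = X + a * v) :
    a * W * (g - κ * (N - Y)) - μ / 2 * ((1 - a) * (X - N) ^ 2 + a * N ^ 2) + μ / 2 * W ^ 2 ≤
      (1 - a) * (μ / 2) * v ^ 2 + a * (g * W) := by
  have hN : N = a * W + (1 - a) * X := by linarith
  have h1a : (1 + a) ≠ 0 := by linarith
  have hNY : (1 + a) * (N - Y) = a * ((1 + a) * W - (v + a * X)) := by
    rw [mul_sub, hY, hN]; ring
  have h1 : a * W * (κ * (N - Y)) = μ * (1 - a) * W * ((1 + a) * W - (v + a * X)) := by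
    have : (1 + a) * (a * W * (κ * (N - Y))) =
        (1 + a) * (μ * (1 - a) * W * ((1 + a) * W - (v + a * X))) := by
      linear_combination a * W * κ * hNY + W * ((1 + a) * W - (v + a * X)) * hκ
    exact mul_left_cancel₀ h1a this
  -- This quantity is exactly the right side minus the left side of the claim.
  have h2 : 0 ≤ (1 - a) * (μ / 2) * ((W - v) ^ 2 + a * (W - X) ^ 2) := by
    have : 0 ≤ 1 - a := by linarith
    positivity
  have h3 : a * W * (g - κ * (N - Y)) = a * (g * W) - a * W * (κ * (N - Y)) := by ring
  rw [h3, h1, hN]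
  nlinarith

/-- One step of the inexact accelerated proximal point method for a quadratic form. The
minimizer is `0`, and `g` is the gradient of the proximal objective at the new point `N`. -/
theorem accelerated_step (hd : ∀ v, 1 ≤ deg G v) {α : ℝ} (hα : 0 < α) (hα1 : α < 1) {a κ : ℝ}
    (ha0 : 0 ≤ a) (ha : a < 1) (hκ : κ * a ^ 2 = α * (1 - a ^ 2)) {g N X W v Y : V → ℝ}
    (hW : ∀ u, a * W u = N u - (1 - a) * X u) (hY : ∀ u, (1 + a) * Y u = X u + a * v u)
    (hg : ∀ u, g u = (Q G α *ᵥ N) u + κ * (N u - Y u)) :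
    1 / 2 * (N ⬝ᵥ Q G α *ᵥ N) + α / 2 * ∑ u, W u ^ 2 ≤
      (1 - a) * (1 / 2 * (X ⬝ᵥ Q G α *ᵥ X) + α / 2 * ∑ u, v u ^ 2) + a * ∑ u, g u * W u := by
  -- Strong convexity is used between N and the old point X with weight 1 - a, and between N and the
  -- minimizer 0 with weight a.
  have h1 := le_Q_form hd hα1 (X - N)
  have h2 := le_Q_form hd hα1 N
  rw [dotProduct_Q_sub] at h1
  have h3 : N ⬝ᵥ Q G α *ᵥ N - (1 - a) * (X ⬝ᵥ Q G α *ᵥ N) =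
      ∑ u, a * W u * (g u - κ * (N u - Y u)) := by
    simp only [dotProduct, mul_sum, ← sum_sub_distrib]
    refine sum_congr rfl fun u _ => ?_
    rw [hW, hg]; ring
  have h4 : ∑ u, (a * W u * (g u - κ * (N u - Y u)) -
      α / 2 * ((1 - a) * (X u - N u) ^ 2 + a * N u ^ 2) + α / 2 * W u ^ 2) ≤
        ∑ u, ((1 - a) * (α / 2) * v u ^ 2 + a * (g u * W u)) :=
    sum_le_sum fun u _ => accelerated_pointwise ha hα.le ha0 hκ (hW u) (hY u)
  simp only [sum_add_distrib, sum_sub_distrib, ← mul_sum] at h4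
  simp only [Pi.sub_apply] at h1
  have h5 := mul_le_mul_of_nonneg_left h1 (by linarith : 0 ≤ 1 - a)
  have h6 := mul_le_mul_of_nonneg_left h2 ha0
  linarith

/-- The bound on the Lyapunov function is preserved if the gradient error is small. -/
theorem lyapunov_bound_step {a α E E' B c w gW gg WW : ℝ} (ha0 : 0 < a) (ha : a < 1)
    (hE' : E' ≤ (1 - a) * E + a * gW) (hWW : α / 2 * WW ≤ E') (hα : 0 < α)
    (hgW : gW ≤ 1 / 60 * (α / 2 * WW) + 30 / α * gg) (hc : 0 ≤ c)
    (hgg : a ^ 2 * gg ≤ 2 * α * (w * (c * (1 - 9 / 10 * a)))) (hw : 3600 * w ≤ a ^ 2 * B)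
    (hB : 0 ≤ B) (hE : E ≤ B * c) :
    E' ≤ B * (c * (1 - 9 / 10 * a)) := by
  have hρ : 0 ≤ 1 - 9 / 10 * a := by linarith
  -- The weight 3600 = 60 · 60 makes the error term at most 1/60 of the new bound.
  have h1 : a ^ 2 * (30 / α * gg) ≤ a ^ 2 * (1 / 60 * (B * (c * (1 - 9 / 10 * a)))) := by
    have e1 : a ^ 2 * (30 / α * gg) = 30 / α * (a ^ 2 * gg) := by ring
    have e2 : 30 / α * (2 * α * (w * (c * (1 - 9 / 10 * a)))) =
        60 * (w * (c * (1 - 9 / 10 * a))) := by field_simp; ring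
    have h2 := mul_le_mul_of_nonneg_left hgg (by positivity : 0 ≤ 30 / α)
    have h3 := mul_le_mul_of_nonneg_right hw (mul_nonneg hc hρ)
    rw [e1]
    linarith
  have h2 := le_of_mul_le_mul_left h1 (by positivity)
  have h3 : a * gW ≤ a * (1 / 60 * E' + 1 / 60 * (B * (c * (1 - 9 / 10 * a)))) :=
    mul_le_mul_of_nonneg_left (by linarith) ha0.le
  have h4 : (1 - a) * E ≤ (1 - a) * (B * c) := mul_le_mul_of_nonneg_left hE (by linarith)
  have hBc : 0 ≤ B * c := mul_nonneg hB hc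
  -- The error is paid for by the gap between the two rates: (1 - a/30)(1 - 9a/10) - (1 - a) =
  -- a(1/15 + 3a/100).
  have h5 : (1 - a / 60) * E' ≤ (1 - a / 60) * (B * (c * (1 - 9 / 10 * a))) := by
    have : 0 ≤ (B * c) * (a * (1 / 15 + 3 / 100 * a)) := by positivity
    nlinarith
  exact le_of_mul_le_mul_left h5 (by linarith)

/-- Young's inequality, weighted so that the W-part is 1/60 of the momentum term of the Lyapunov
function and can be absorbed. -/
theorem sum_mul_le_weighted {α : ℝ} (hα : 0 < α) (g W : V → ℝ) :
    ∑ u, g u * W u ≤ 1 / 60 * (α / 2 * ∑ u, W u ^ 2) + 30 / α * ∑ u, g u ^ 2 := by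
  simp only [mul_sum, ← sum_add_distrib]
  refine sum_le_sum fun u _ => ?_
  have h : 0 ≤ 30 / α * (g u - α / 60 * W u) ^ 2 := by positivity
  have e : 30 / α * (g u - α / 60 * W u) ^ 2 =
      1 / 60 * (α / 2 * W u ^ 2) + 30 / α * g u ^ 2 - g u * W u := by
    field_simp; ring
  linarith

/-! ### The PPR vector and the minimizer of the objective -/

/-- The operator `g ↦ (1 + α)/2 g - (1 - α)/2 D⁻¹ A g`. -/
def walkOp (G : SimpleGraph V) [DecidableRel G.Adj] (α : ℝ) (g : V → ℝ) (v : V) : ℝ :=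
  (1 + α) / 2 * g v - (1 - α) / 2 * ((deg G v)⁻¹ * ∑ u, G.adjMatrix ℝ v u * g u)

/-- The maximum principle for `walkOp`. -/
theorem abs_le_of_abs_walkOp_le (hd : ∀ v, 1 ≤ deg G v) {α b : ℝ} (hα : 0 < α) (hα1 : α < 1)
    (g : V → ℝ) (h : ∀ v, |walkOp G α g v| ≤ α * b) (v : V) : |g v| ≤ b := by
  obtain ⟨w, -, hw⟩ := exists_max_image univ (fun u => |g u|) ⟨v, mem_univ v⟩
  refine (hw v (mem_univ v)).trans ?_
  have hdw : 0 < deg G w := by linarith [hd w]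
  -- At a maximizer of |g| the neighbour average is no larger than |g w|, so (1+α)/2 - (1-α)/2 = α
  -- remains as coefficient.
  have h1 : |(deg G w)⁻¹ * ∑ u, G.adjMatrix ℝ w u * g u| ≤ |g w| := by
    rw [abs_mul, abs_of_pos (inv_pos.2 hdw), inv_mul_le_iff₀ hdw]
    calc |∑ u, G.adjMatrix ℝ w u * g u| ≤ ∑ u, G.adjMatrix ℝ w u * |g w| := by
          refine (abs_sum_le_sum_abs _ _).trans (sum_le_sum fun u _ => ?_)
          rw [abs_mul, abs_of_nonneg (adjMatrix_nonneg w u)]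
          exact mul_le_mul_of_nonneg_left (hw u (mem_univ u)) (adjMatrix_nonneg w u)
      _ = deg G w * |g w| := by rw [← sum_mul, sum_adjMatrix_row]
  have h2 := h w
  unfold walkOp at h2
  set c := (deg G w)⁻¹ * ∑ u, G.adjMatrix ℝ w u * g u
  have h3 : |(1 + α) / 2 * g w| ≤
      |(1 + α) / 2 * g w - (1 - α) / 2 * c| + |(1 - α) / 2 * c| := by
    simpa using abs_add_le ((1 + α) / 2 * g w - (1 - α) / 2 * c) ((1 - α) / 2 * c)
  rw [abs_mul ((1 + α) / 2), abs_mul ((1 - α) / 2), abs_of_pos (by linarith : 0 < (1 + α) / 2),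
    abs_of_pos (by linarith : 0 < (1 - α) / 2)] at h3
  have h4 : (1 - α) / 2 * |c| ≤ (1 - α) / 2 * |g w| :=
    mul_le_mul_of_nonneg_left h1 (by linarith)
  have h5 : α * |g w| ≤ α * b := by linarith
  exact le_of_mul_le_mul_left h5 hα

theorem pprMatrix_mulVec_apply (hd : ∀ v, 1 ≤ deg G v) (α : ℝ) (w : V → ℝ) (v : V) :
    (pprMatrix G α *ᵥ w) v = deg G v * walkOp G α (fun u => w u / deg G u) v := by
  have hdv : deg G v ≠ 0 := by linarith [hd v]
  unfold pprMatrix walkOp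
  rw [sub_mulVec, smul_mulVec, add_mulVec, one_mulVec]
  simp only [Pi.sub_apply, Pi.smul_apply, Pi.add_apply, smul_eq_mul]
  have e : ((G.adjMatrix ℝ * diagonal fun v => (deg G v)⁻¹) *ᵥ w) v =
      ∑ u, G.adjMatrix ℝ v u * (w u / deg G u) := by
    simp only [mulVec, dotProduct, mul_diagonal]
    exact sum_congr rfl fun u _ => by ring
  rw [e]
  field_simp
  ring

/-- The maximum principle with b = 0 gives a trivial kernel. -/
theorem isUnit_pprMatrix (hd : ∀ v, 1 ≤ deg G v) {α : ℝ} (hα : 0 < α) (hα1 : α < 1) :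
    IsUnit (pprMatrix G α) := by
  rw [← mulVec_injective_iff_isUnit]
  intro x y hxy
  have h0 : pprMatrix G α *ᵥ (x - y) = 0 := by
    rw [mulVec_sub]; exact sub_eq_zero.2 hxy
  funext v
  have hdv : 0 < deg G v := by linarith [hd v]
  have h1 := abs_le_of_abs_walkOp_le (b := 0) hd hα hα1 (fun u => (x - y) u / deg G u)
    (fun u => by
      have h2 := congrFun h0 u
      rw [pprMatrix_mulVec_apply hd] at h2
      have h3 : deg G u ≠ 0 := by linarith [hd u]
      rw [(mul_eq_zero.1 h2).resolve_left h3]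
      simp) v
  have h2 := abs_nonpos_iff.1 h1
  have h3 := (div_eq_zero_iff.1 h2).resolve_right hdv.ne'
  exact sub_eq_zero.1 h3

theorem pprMatrix_mulVec_ppr (hd : ∀ v, 1 ≤ deg G v) {α : ℝ} (hα : 0 < α) (hα1 : α < 1)
    (s : V) : pprMatrix G α *ᵥ ppr G α s = α • Pi.single s (1 : ℝ) := by
  unfold ppr
  rw [mulVec_mulVec, mul_nonsing_inv _ ((isUnit_iff_isUnit_det _).1 (isUnit_pprMatrix hd hα hα1)),
    one_mulVec]

/-- The minimizer `D^{-1/2} π` of the quadratic objective. -/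
def optimum (G : SimpleGraph V) [DecidableRel G.Adj] (α : ℝ) (s : V) (v : V) : ℝ :=
  (√(deg G v))⁻¹ * ppr G α s v

theorem Q_mulVec_eq_walkOp (hd : ∀ v, 1 ≤ deg G v) (α : ℝ) (x : V → ℝ) (v : V) :
    (Q G α *ᵥ x) v = √(deg G v) * walkOp G α (fun u => (√(deg G u))⁻¹ * x u) v := by
  have h0 : √(deg G v) ≠ 0 := (Real.sqrt_pos.2 (by linarith [hd v])).ne'
  have h1 : (deg G v)⁻¹ = (√(deg G v))⁻¹ * (√(deg G v))⁻¹ := by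
    rw [← mul_inv, Real.mul_self_sqrt (by linarith [hd v])]
  rw [Q_mulVec_apply]
  unfold walkOp
  have e : ∑ u, (√(deg G v))⁻¹ * G.adjMatrix ℝ v u * (√(deg G u))⁻¹ * x u =
      (√(deg G v))⁻¹ * ∑ u, G.adjMatrix ℝ v u * ((√(deg G u))⁻¹ * x u) := by
    rw [mul_sum]; exact sum_congr rfl fun u _ => by ring
  rw [e, h1]
  field_simp

theorem Q_mulVec_optimum (hd : ∀ v, 1 ≤ deg G v) {α : ℝ} (hα : 0 < α) (hα1 : α < 1) (s v : V) :
    (Q G α *ᵥ optimum G α s) v = α * (√(deg G v))⁻¹ * (Pi.single s (1 : ℝ) : V → ℝ) v := by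
  have h0 : √(deg G v) ≠ 0 := (Real.sqrt_pos.2 (by linarith [hd v])).ne'
  have h1 := congrFun (pprMatrix_mulVec_ppr hd hα hα1 s) v
  rw [pprMatrix_mulVec_apply hd] at h1
  have e : (fun u => (√(deg G u))⁻¹ * optimum G α s u) = fun u => ppr G α s u / deg G u := by
    funext u
    unfold optimum
    rw [← mul_assoc, ← mul_inv, Real.mul_self_sqrt (by linarith [hd u])]
    ring
  rw [Q_mulVec_eq_walkOp hd, e]
  have h2 : deg G v = √(deg G v) * √(deg G v) := (Real.mul_self_sqrt (by linarith [hd v])).symm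
  simp only [Pi.smul_apply, smul_eq_mul] at h1
  rw [mul_assoc, mul_comm _ ((Pi.single s (1 : ℝ) : V → ℝ) v), ← mul_assoc, ← h1]
  nth_rewrite 2 [h2]
  field_simp

theorem gradF_eq (hd : ∀ v, 1 ≤ deg G v) {α : ℝ} (hα : 0 < α) (hα1 : α < 1) (s : V)
    (x : V → ℝ) (v : V) : gradF G α s x v = (Q G α *ᵥ (x - optimum G α s)) v := by
  unfold gradF
  rw [mulVec_sub, Pi.sub_apply, Q_mulVec_optimum hd hα hα1]

/-- The form equals α p x with p = d_s^{-1/2} and x the entry at s. Strong convexity gives x² ≤ p x,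
and 2 p x ≤ p² + x² ≤ 1 + p x then gives p x ≤ 1. -/
theorem optimum_form_le (hd : ∀ v, 1 ≤ deg G v) {α : ℝ} (hα : 0 < α) (hα1 : α < 1) (s : V) :
    optimum G α s ⬝ᵥ Q G α *ᵥ optimum G α s ≤ α := by
  have h1 := le_Q_form hd hα1 (optimum G α s)
  have h2 : optimum G α s ⬝ᵥ Q G α *ᵥ optimum G α s =
      α * ((√(deg G s))⁻¹ * optimum G α s s) := by
    unfold dotProduct
    simp only [Q_mulVec_optimum hd hα hα1]
    rw [sum_eq_single s]
    · simp; ring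
    · intro b _ hb; simp [hb]
    · simp
  have h3 : optimum G α s s ^ 2 ≤ ∑ v, optimum G α s v ^ 2 :=
    single_le_sum (f := fun v => optimum G α s v ^ 2) (fun _ _ => sq_nonneg _) (mem_univ s)
  have h4 : (√(deg G s))⁻¹ ^ 2 ≤ 1 := by
    rw [inv_pow, Real.sq_sqrt (by linarith [hd s])]
    exact inv_le_one_of_one_le₀ (hd s)
  rw [h2] at h1 ⊢
  have h5 : ∑ v, optimum G α s v ^ 2 ≤ (√(deg G s))⁻¹ * optimum G α s s :=
    le_of_mul_le_mul_left h1 hα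
  nlinarith [sq_nonneg ((√(deg G s))⁻¹ - optimum G α s s)]

end Acceleration

/-! ### Rates, accuracies and the maximal number of outer iterations -/

section Parameters

/-- The contraction factor `1 - (9/10) √(α/(1 - α))` of the accuracies. -/
def contraction (α : ℝ) : ℝ := 1 - 9 / 10 * √(α / (1 - α))

variable {α ε : ℝ}

theorem sqrt_ratio_sq (hα : 0 < α) (hα2 : α < 1 / 2) : √(α / (1 - α)) ^ 2 = α / (1 - α) :=
  Real.sq_sqrt (div_nonneg hα.le (by linarith))

theorem sqrt_ratio_pos (hα : 0 < α) (hα2 : α < 1 / 2) : 0 < √(α / (1 - α)) :=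
  Real.sqrt_pos.2 (div_pos hα (by linarith))

theorem sqrt_ratio_lt_one (hα : 0 < α) (hα2 : α < 1 / 2) : √(α / (1 - α)) < 1 := by
  rw [Real.sqrt_lt' one_pos, one_pow, div_lt_one (by linarith)]
  linarith

theorem contraction_gt (hα : 0 < α) (hα2 : α < 1 / 2) : 1 / 10 < contraction α := by
  unfold contraction; linarith [sqrt_ratio_lt_one hα hα2]

theorem contraction_lt_one (hα : 0 < α) (hα2 : α < 1 / 2) : contraction α < 1 := by
  unfold contraction; linarith [sqrt_ratio_pos hα hα2]

theorem contraction_pos (hα : 0 < α) (hα2 : α < 1 / 2) : 0 < contraction α := by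
  linarith [contraction_gt hα hα2]

theorem accuracy_eq (α : ℝ) (t : ℕ) : accuracy α t = (1 + α) / 18 * contraction α ^ t := rfl

theorem accuracy_pos (hα : 0 < α) (hα2 : α < 1 / 2) (t : ℕ) : 0 < accuracy α t := by
  rw [accuracy_eq]
  have := contraction_pos hα hα2
  positivity

theorem momentum_mul (hα : 0 < α) (hα2 : α < 1 / 2) :
    (1 + √(α / (1 - α))) * momentum α = 1 - √(α / (1 - α)) := by
  have h1 : 0 < √(1 - α) := Real.sqrt_pos.2 (by linarith)
  have h2 : 0 < √α := Real.sqrt_pos.2 hα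
  unfold momentum
  rw [Real.sqrt_div hα.le]
  field_simp

theorem log_two_le_log_inv (hα : 0 < α) (hα2 : α < 1 / 2) (hε : 0 < ε) (hε1 : ε < 1) :
    Real.log 2 ≤ Real.log (1 / (α * ε)) := by
  refine Real.log_le_log (by norm_num) ?_
  rw [le_div_iff₀ (by positivity)]
  nlinarith

/-- The constant 400 is below 2⁹ and log 2 ≤ log(1/(αε)), whence 9 + 2 = 11. -/
theorem log_outer_le (hα : 0 < α) (hα2 : α < 1 / 2) (hε : 0 < ε) (hε1 : ε < 1) :
    Real.log (400 * (1 - α ^ 2) / (α ^ 2 * ε ^ 2)) ≤ 11 * Real.log (1 / (α * ε)) := by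
  have h1 := log_two_le_log_inv hα hα2 hε hε1
  have h2 : 400 * (1 - α ^ 2) / (α ^ 2 * ε ^ 2) ≤ 2 ^ 9 * (1 / (α * ε)) ^ 2 := by
    rw [div_pow, mul_pow, one_pow, mul_one_div]
    refine div_le_div_of_nonneg_right ?_ (by positivity)
    nlinarith [sq_nonneg α]
  have h3 : 0 < 400 * (1 - α ^ 2) / (α ^ 2 * ε ^ 2) := by
    have : 0 < 1 - α ^ 2 := by nlinarith
    positivity
  have h4 := Real.log_le_log h3 h2
  rw [Real.log_mul (by positivity) (by positivity), Real.log_pow, Real.log_pow] at h4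
  push_cast at h4
  linarith

theorem log_outer_pos (hα : 0 < α) (hα2 : α < 1 / 2) (hε : 0 < ε) (hε1 : ε < 1) :
    0 < Real.log (400 * (1 - α ^ 2) / (α ^ 2 * ε ^ 2)) := by
  refine Real.log_pos ?_
  rw [lt_div_iff₀ (by positivity)]
  have h1 : α ^ 2 < 1 / 4 := by nlinarith
  have h2 : ε ^ 2 < 1 := by nlinarith
  nlinarith [sq_nonneg α, sq_nonneg ε]

theorem sqrt_inv_ratio_mul (hα : 0 < α) (hα2 : α < 1 / 2) :
    √((1 - α) / α) * √(α / (1 - α)) = 1 := by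
  have : (1 - α) ≠ 0 := by linarith
  rw [← Real.sqrt_mul (div_nonneg (by linarith) hα.le)]
  rw [show (1 - α) / α * (α / (1 - α)) = 1 by field_simp, Real.sqrt_one]

theorem one_le_maxOuter (hα : 0 < α) (hα2 : α < 1 / 2) (hε : 0 < ε) (hε1 : ε < 1) :
    1 ≤ maxOuter α ε := by
  refine Nat.one_le_ceil_iff.2 ?_
  have h1 : 0 < √((1 - α) / α) := Real.sqrt_pos.2 (div_pos (by linarith) hα)
  have h2 := log_outer_pos hα hα2 hε hε1
  positivity

theorem maxOuter_lt (hα : 0 < α) (hα2 : α < 1 / 2) (hε : 0 < ε) (hε1 : ε < 1) :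
    (maxOuter α ε : ℝ) < 10 / 9 * √((1 - α) / α) *
      Real.log (400 * (1 - α ^ 2) / (α ^ 2 * ε ^ 2)) + 1 :=
  Nat.ceil_lt_add_one (by have := log_outer_pos hα hα2 hε hε1; positivity)

theorem maxOuter_le (hα : 0 < α) (hα2 : α < 1 / 2) (hε : 0 < ε) (hε1 : ε < 1) :
    (maxOuter α ε : ℝ) ≤ 15 * Real.log (1 / (α * ε)) / √α := by
  have h1 := maxOuter_lt hα hα2 hε hε1
  have h2 := log_outer_le hα hα2 hε hε1
  have h0 := log_outer_pos hα hα2 hε hε1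
  have h3 := log_two_le_log_inv hα hα2 hε hε1
  have h4 := Real.log_two_gt_d9
  have hs : 0 < √α := Real.sqrt_pos.2 hα
  have hs1 : √α ≤ 1 := Real.sqrt_le_one.2 (by linarith)
  have h5 : √((1 - α) / α) ≤ 1 / √α := by
    rw [Real.sqrt_div (by linarith)]
    exact div_le_div_of_nonneg_right (Real.sqrt_le_one.2 (by linarith)) hs.le
  rw [le_div_iff₀ hs]
  have h6 : √((1 - α) / α) * √α ≤ 1 := by
    rwa [le_div_iff₀ hs] at h5
  set Λ := Real.log (400 * (1 - α ^ 2) / (α ^ 2 * ε ^ 2))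
  have h7 : √((1 - α) / α) * √α * Λ ≤ 1 * Λ := mul_le_mul_of_nonneg_right h6 h0.le
  have h8 := mul_lt_mul_of_pos_right h1 hs
  -- The logarithm contributes (10/9) · 11 < 12.3, and rounding up at most 1 ≤ 1.5 log(1/(αε)).
  nlinarith

/-- At the maximal number of outer iterations the accuracy is of the order `α² ε²`, as long as
`α` is small compared with the logarithm of `1/(α ε)`. -/
theorem contraction_pow_lower (hα : 0 < α) (hα2 : α < 1 / 2) (hε : 0 < ε) (hε1 : ε < 1)
    (hsmall : α * Real.log (1 / (α * ε)) ^ 2 ≤ 1) {T : ℕ} (hT : T ≤ maxOuter α ε) :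
    α ^ 2 * ε ^ 2 ≤ 400 * Real.exp 160 * contraction α ^ T := by
  set ℓ := Real.log (1 / (α * ε)) with hℓ
  set Λ := Real.log (400 * (1 - α ^ 2) / (α ^ 2 * ε ^ 2)) with hΛ
  set a := √(α / (1 - α)) with ha
  have h0 : 0 < Λ := log_outer_pos hα hα2 hε hε1
  have h1 : Λ ≤ 11 * ℓ := log_outer_le hα hα2 hε hε1
  have ha0 : 0 < a := sqrt_ratio_pos hα hα2
  have ha1 : a < 1 := sqrt_ratio_lt_one hα hα2
  have hc0 := contraction_pos hα hα2
  have hcg := contraction_gt hα hα2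
  have hc : contraction α = 1 - 9 / 10 * a := rfl
  have hℓ0 : 0 < ℓ := by linarith
  have haℓ : a * ℓ ≤ 3 / 2 := by
    have h2 : (a * ℓ) ^ 2 ≤ (3 / 2) ^ 2 := by
      have h3 : a ^ 2 ≤ 2 * α := by
        rw [ha, sqrt_ratio_sq hα hα2, div_le_iff₀ (by linarith)]
        nlinarith
      rw [mul_pow]
      nlinarith [sq_nonneg ℓ]
    exact le_of_sq_le_sq h2 (by norm_num)
  -- For x = 9a/10 one has 1/(1 - x) = 1 + x + x²/(1 - x) with 1 - x > 1/10, hence the coefficient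
  -- 81/10.
  have hlog : -(9 / 10 * a + 81 / 10 * a ^ 2) ≤ Real.log (contraction α) := by
    refine le_trans ?_ (Real.one_sub_inv_le_log_of_pos hc0)
    have h2 : (contraction α)⁻¹ ≤ 1 + (9 / 10 * a + 81 / 10 * a ^ 2) := by
      rw [inv_le_iff_one_le_mul₀ hc0, hc]
      nlinarith [sq_nonneg a, mul_pos ha0 ha0]
    linarith
  have hTle : (T : ℝ) ≤ 10 / 9 * √((1 - α) / α) * Λ + 1 :=
    (Nat.cast_le.2 hT).trans (maxOuter_lt hα hα2 hε hε1).le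
  have hinv := sqrt_inv_ratio_mul hα hα2
  rw [← ha] at hinv
  -- The linear term of the logarithm, times the cap on T, gives Λ. The quadratic one gives 9aΛ ≤ 9
  -- · 33/2, bounded because α is small; rounding up adds at most 9.
  have hexp : -(Λ + 160) ≤ T * Real.log (contraction α) := by
    have h2 : (T : ℝ) * (9 / 10 * a + 81 / 10 * a ^ 2) ≤
        (10 / 9 * √((1 - α) / α) * Λ + 1) * (9 / 10 * a + 81 / 10 * a ^ 2) :=
      mul_le_mul_of_nonneg_right hTle (by positivity)
    have h3 : (10 / 9 * √((1 - α) / α) * Λ + 1) * (9 / 10 * a + 81 / 10 * a ^ 2) =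
        Λ + 9 * (a * Λ) + 9 / 10 * a + 81 / 10 * a ^ 2 := by
      linear_combination (Λ + 9 * a * Λ) * hinv
    have h4 : a * Λ ≤ 33 / 2 := by nlinarith
    have h5 : a ^ 2 ≤ 1 := by nlinarith
    have h6 := mul_le_mul_of_nonneg_left hlog (Nat.cast_nonneg (α := ℝ) T)
    have h7 : 9 * (a * Λ) + 9 / 10 * a + 81 / 10 * a ^ 2 ≤ 158 := by linarith
    linarith
  have h2 : Real.exp (-(Λ + 160)) ≤ contraction α ^ T := by
    rw [← Real.exp_log (pow_pos hc0 T), Real.log_pow]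
    exact Real.exp_le_exp.2 hexp
  have h3 : α ^ 2 * ε ^ 2 = 400 * (1 - α ^ 2) * (Real.exp 160 * Real.exp (-(Λ + 160))) := by
    have h4 : 0 < 1 - α ^ 2 := by nlinarith
    rw [← Real.exp_add, show 160 + -(Λ + 160) = -Λ by ring, Real.exp_neg, hΛ,
      Real.exp_log (by positivity)]
    field_simp
  have h4 : 0 ≤ Real.exp 160 * Real.exp (-(Λ + 160)) := by positivity
  have h5 : Real.exp 160 * Real.exp (-(Λ + 160)) ≤ Real.exp 160 * contraction α ^ T :=
    mul_le_mul_of_nonneg_left h2 (Real.exp_pos _).le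
  rw [h3]
  nlinarith [sq_nonneg α]

end Parameters

/-! ### Convergence of the outer loop -/

section Outer

variable {V : Type*} [Fintype V] [DecidableEq V] {G : SimpleGraph V} [DecidableRel G.Adj]
variable {α ε : ℝ}

/-- The Lyapunov function of the outer loop decreases at the rate of the accuracies. -/
theorem iterate_bound (hd : ∀ v, 1 ≤ deg G v) (hm : 0 < numEdges G) (M : LocalSolver)
    (L : AdjLists G) (hα : 0 < α) (hα2 : α < 1 / 2) (s : V) (t : ℕ) :
    ∃ v : V → ℝ,
      (∀ u, (1 + √(α / (1 - α))) * ((iterate M L α s t).2 - optimum G α s) u =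
        ((iterate M L α s t).1 - optimum G α s) u + √(α / (1 - α)) * v u) ∧
      1 / 2 * (((iterate M L α s t).1 - optimum G α s) ⬝ᵥ
          Q G α *ᵥ ((iterate M L α s t).1 - optimum G α s)) + α / 2 * ∑ u, v u ^ 2 ≤
        200 * (1 - α ^ 2) / α * contraction α ^ t := by
  have hα1 : α < 1 := by linarith
  have ha0 := sqrt_ratio_pos hα hα2
  have ha1 := sqrt_ratio_lt_one hα hα2
  have hasq := sqrt_ratio_sq hα hα2
  have hmom := momentum_mul hα hα2
  have hc0 := contraction_pos hα hα2
  set a := √(α / (1 - α)) with ha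
  set x₀ := optimum G α s with hx₀
  have hne : (1 : ℝ) - α ≠ 0 := by linarith
  induction t with
  | zero =>
    refine ⟨-x₀, fun u => ?_, ?_⟩
    · simp only [iterate, Pi.sub_apply, Pi.zero_apply, Pi.neg_apply]; ring
    · have h1 := optimum_form_le hd hα hα1 s
      have h2 := le_Q_form hd hα1 x₀
      have h3 : (0 - x₀) ⬝ᵥ Q G α *ᵥ (0 - x₀) = x₀ ⬝ᵥ Q G α *ᵥ x₀ := by
        rw [zero_sub, mulVec_neg, neg_dotProduct_neg]
      simp only [iterate, pow_zero, mul_one, Pi.neg_apply, neg_sq]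
      rw [h3]
      have h4 : α ≤ 200 * (1 - α ^ 2) / α := by
        rw [le_div_iff₀ hα]; nlinarith
      linarith
  | succ t ih =>
    obtain ⟨v, hY, hE⟩ := ih
    set X := (iterate M L α s t).1 with hX
    set Y := (iterate M L α s t).2 with hYdef
    set N := (iterate M L α s (t + 1)).1 with hN
    have hNout : N = (M.call L α s (1 - 2 * α) (accuracy α (t + 1)) Y).output := rfl
    have hY' : (iterate M L α s (t + 1)).2 = N + momentum α • (N - X) := rfl
    have hout := sum_sq_gradH_output_le hd hm M L hα1 s (accuracy_pos hα hα2 (t + 1)) Y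
    rw [← hNout] at hout
    set g := gradH G α s (1 - 2 * α) Y N with hg
    -- The usual auxiliary sequence of acceleration: extrapolate from the old iterate through the
    -- new one by the factor 1/a, relative to the optimum.
    set W : V → ℝ := fun u => (N u - X u) / a + (X - x₀) u with hW
    have haW : ∀ u, a * W u = (N - x₀) u - (1 - a) * (X - x₀) u := fun u => by
      simp only [hW, Pi.sub_apply]; field_simp; ring
    refine ⟨W, fun u => ?_, ?_⟩
    · rw [hY', haW]
      simp only [Pi.sub_apply, Pi.add_apply, Pi.smul_apply, smul_eq_mul]
      linear_combination (N u - X u) * hmom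
    · have hstep := accelerated_step hd hα hα1 (κ := 1 - 2 * α) ha0.le ha1
        (by rw [hasq]; field_simp; ring) (g := g) haW hY (fun u => by
          rw [hg]; unfold gradH
          rw [gradF_eq hd hα hα1]
          simp only [Pi.sub_apply]; ring)
      have h1 := le_Q_form hd hα1 (N - x₀)
      have h2 : 0 ≤ ∑ u, (N - x₀) u ^ 2 := sum_nonneg fun _ _ => sq_nonneg _
      rw [pow_succ]
      refine lyapunov_bound_step (w := (1 + α) / 18) ha0 ha1 hstep ?_ hα
        (sum_mul_le_weighted hα g W) (pow_nonneg hc0.le t) ?_ ?_ ?_ hE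
      · nlinarith
      · rw [accuracy_eq, pow_succ] at hout
        change a ^ 2 * _ ≤ 2 * α * ((1 + α) / 18 * (contraction α ^ t * contraction α))
        rw [hasq, div_mul_eq_mul_div, div_le_iff₀ (by linarith)]
        have := mul_le_mul_of_nonneg_left hout hα.le
        linarith
      -- The constants 18 and 200 are matched here: 3600 (1+α)/18 = 200 (1+α) = a² · 200(1-α²)/α.
      · rw [hasq]
        apply le_of_eq
        field_simp
        ring
      · exact div_nonneg (mul_nonneg (by norm_num) (by nlinarith)) hα.le

theorem iterate_form_le (hd : ∀ v, 1 ≤ deg G v) (hm : 0 < numEdges G) (M : LocalSolver)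
    (L : AdjLists G) (hα : 0 < α) (hα2 : α < 1 / 2) (s : V) (t : ℕ) :
    ((iterate M L α s t).1 - optimum G α s) ⬝ᵥ
      Q G α *ᵥ ((iterate M L α s t).1 - optimum G α s) ≤
        400 * (1 - α ^ 2) / α * contraction α ^ t := by
  obtain ⟨v, -, h⟩ := iterate_bound hd hm M L hα hα2 s t
  have : 0 ≤ α / 2 * ∑ u, v u ^ 2 :=
    mul_nonneg (by linarith) (sum_nonneg fun _ _ => sq_nonneg _)
  have e : 400 * (1 - α ^ 2) / α * contraction α ^ t =
    2 * (200 * (1 - α ^ 2) / α * contraction α ^ t) := by ring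
  rw [e]
  linarith

/-- The error of y is the convex combination (X + a v)/(1 + a), and the Lyapunov function controls
α/2 times the squared norms of both X and v. -/
theorem sum_sq_extrapolated_le (hd : ∀ v, 1 ≤ deg G v) (hm : 0 < numEdges G) (M : LocalSolver)
    (L : AdjLists G) (hα : 0 < α) (hα2 : α < 1 / 2) (s : V) (t : ℕ) :
    ∑ u, ((iterate M L α s t).2 - optimum G α s) u ^ 2 ≤ 400 / α ^ 2 := by
  obtain ⟨v, hY, hE⟩ := iterate_bound hd hm M L hα hα2 s t
  have h1 := le_Q_form hd (by linarith : α < 1) ((iterate M L α s t).1 - optimum G α s)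
  have ha0 := sqrt_ratio_pos hα hα2
  set a := √(α / (1 - α))
  set X := (iterate M L α s t).1 - optimum G α s
  set Y := (iterate M L α s t).2 - optimum G α s
  have h2 : ∑ u, Y u ^ 2 ≤ ∑ u, X u ^ 2 + ∑ u, v u ^ 2 := by
    rw [← sum_add_distrib]
    refine sum_le_sum fun u _ => ?_
    have h3 : (1 + a) ^ 2 * Y u ^ 2 ≤ (1 + a) ^ 2 * (X u ^ 2 + v u ^ 2) := by
      rw [← mul_pow, hY]
      nlinarith [mul_nonneg ha0.le (sq_nonneg (X u - v u)), mul_nonneg ha0.le (sq_nonneg (X u)),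
        mul_nonneg ha0.le (sq_nonneg (v u)), sq_nonneg (a * X u), sq_nonneg (v u)]
    exact le_of_mul_le_mul_left h3 (by positivity)
  have h4 : 200 * (1 - α ^ 2) / α * contraction α ^ t ≤ 200 / α := by
    have h5 := pow_le_one₀ (n := t) (contraction_pos hα hα2).le (contraction_lt_one hα hα2).le
    calc 200 * (1 - α ^ 2) / α * contraction α ^ t ≤ 200 * (1 - α ^ 2) / α * 1 :=
          mul_le_mul_of_nonneg_left h5
            (div_nonneg (mul_nonneg (by norm_num) (by nlinarith)) hα.le)
      _ ≤ 200 / α := by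
          rw [mul_one]
          exact div_le_div_of_nonneg_right (by nlinarith) hα.le
  have h6 : α / 2 * ∑ u, Y u ^ 2 ≤ α / 2 * (400 / α ^ 2) := by
    have e : α / 2 * (400 / α ^ 2) = 200 / α := by field_simp; norm_num
    rw [e]
    nlinarith
  exact le_of_mul_le_mul_left h6 (by positivity)

/-- The proximal term vanishes at y, so the gradient is Q applied to the error of y; then
Cauchy-Schwarz with Σ d_u = 2m. -/
theorem initNorm_sq_le (hd : ∀ v, 1 ≤ deg G v) (hm : 0 < numEdges G) (M : LocalSolver)
    (L : AdjLists G) (hα : 0 < α) (hα2 : α < 1 / 2) (s : V) (t : ℕ) :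
    initNorm M L α s t ^ 2 ≤ 800 * numEdges G / α ^ 2 := by
  have hα1 : α < 1 := by linarith
  set Y := (iterate M L α s (t - 1)).2 with hY
  have h1 : ∀ u, gradH G α s (1 - 2 * α) Y Y u = (Q G α *ᵥ (Y - optimum G α s)) u := fun u => by
    unfold gradH
    rw [gradF_eq hd hα hα1]; ring
  have h2 := (sum_sq_Q_mulVec_le hd hα hα1 (Y - optimum G α s)).trans
    ((Q_form_le hd hα1 _).trans (sum_sq_extrapolated_le hd hm M L hα hα2 s (t - 1)))
  have h3 := sum_mul_sq_le_sq_mul_sq univ (fun u => √(deg G u))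
    (fun u => |gradH G α s (1 - 2 * α) Y Y u|)
  have h4 : ∑ u, √(deg G u) ^ 2 = 2 * numEdges G := by
    rw [← sum_deg]
    exact sum_congr rfl fun u _ => Real.sq_sqrt (by linarith [hd u])
  have h5 : initNorm M L α s t = ∑ u, √(deg G u) * |gradH G α s (1 - 2 * α) Y Y u| :=
    sum_congr rfl fun u _ => by rw [abs_mul, abs_of_nonneg (Real.sqrt_nonneg _)]
  rw [h5]
  refine h3.trans ?_
  rw [h4]
  simp only [sq_abs, h1]
  calc 2 * numEdges G * ∑ u, (Q G α *ᵥ (Y - optimum G α s)) u ^ 2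
      ≤ 2 * numEdges G * (400 / α ^ 2) := mul_le_mul_of_nonneg_left h2 (by positivity)
    _ = 800 * numEdges G / α ^ 2 := by ring

/-- At 0 the gradient is -α D^{-1/2} e_s, and the scaling by √d_s cancels the degree. This turns R
into a bound for max C⁰. -/
theorem initNorm_one (hd : ∀ v, 1 ≤ deg G v) (M : LocalSolver) (L : AdjLists G) (hα : 0 < α)
    (s : V) : initNorm M L α s 1 = α := by
  unfold initNorm gradNorm
  have hs : √(deg G s) ≠ 0 := (Real.sqrt_pos.2 (by linarith [hd s])).ne'
  have h1 : ∀ v, gradH G α s (1 - 2 * α) 0 0 v =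
      -(α * (√(deg G v))⁻¹ * (Pi.single s (1 : ℝ) : V → ℝ) v) := fun v => by
    unfold gradH gradF; simp
  change ∑ v, |√(deg G v) * gradH G α s (1 - 2 * α) 0 0 v| = α
  simp only [h1]
  rw [sum_eq_single s]
  · rw [Pi.single_eq_same, mul_one, mul_neg, abs_neg, mul_comm α, ← mul_assoc, mul_inv_cancel₀ hs,
      one_mul, abs_of_pos hα]
  · intro b _ hb; simp [hb]
  · simp

/-! ### The number of outer iterations -/

theorem numOuter_mem (M : LocalSolver) (L : AdjLists G) (s : V) (hT : 1 ≤ maxOuter α ε) :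
    1 ≤ numOuter M L α ε s ∧
      (numOuter M L α ε s = maxOuter α ε ∨ Stops M L α ε s (numOuter M L α ε s)) :=
  Nat.sInf_mem (s := {t | 1 ≤ t ∧ (t = maxOuter α ε ∨ Stops M L α ε s t)})
    ⟨maxOuter α ε, hT, Or.inl rfl⟩

theorem numOuter_le (M : LocalSolver) (L : AdjLists G) (s : V) (hT : 1 ≤ maxOuter α ε) :
    numOuter M L α ε s ≤ maxOuter α ε :=
  Nat.sInf_le ⟨hT, Or.inl rfl⟩

theorem not_stops_of_lt (M : LocalSolver) (L : AdjLists G) (s : V) {t : ℕ} (ht : 1 ≤ t)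
    (hlt : t < numOuter M L α ε s) : ¬ Stops M L α ε s t := fun h =>
  Nat.notMem_of_lt_sInf hlt ⟨ht, Or.inr h⟩

theorem result_accuracy (hd : ∀ v, 1 ≤ deg G v) (hm : 0 < numEdges G) (M : LocalSolver)
    (L : AdjLists G) (hα : 0 < α) (hα2 : α < 1 / 2) (hε : 0 < ε) (hε1 : ε < 1) (s v : V) :
    |(result M L α ε s v - ppr G α s v) / deg G v| ≤ ε := by
  have hα1 : α < 1 := by linarith
  obtain ⟨hT1, hT⟩ := numOuter_mem M L s (one_le_maxOuter hα hα2 hε hε1)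
  unfold result
  set T := numOuter M L α ε s
  set X := (iterate M L α s T).1 with hX
  have hsq : ∀ u, 0 < √(deg G u) := fun u => Real.sqrt_pos.2 (by linarith [hd u])
  have hdd : ∀ u, deg G u = √(deg G u) * √(deg G u) := fun u =>
    (Real.mul_self_sqrt (by linarith [hd u])).symm
  have h1 : (√(deg G v) * X v - ppr G α s v) / deg G v =
      (√(deg G v))⁻¹ * (X - optimum G α s) v := by
    have h2 := hsq v
    have h3 : ppr G α s v / deg G v = (√(deg G v))⁻¹ * ((√(deg G v))⁻¹ * ppr G α s v) := by
      rw [← mul_assoc, ← mul_inv, ← hdd]; ring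
    have h4 : √(deg G v) * X v / deg G v = (√(deg G v))⁻¹ * X v := by
      nth_rewrite 2 [hdd v]
      field_simp
    rw [sub_div, h3, h4, Pi.sub_apply]
    unfold optimum
    ring
  rw [h1]
  -- At the maximal count, the Lyapunov bound makes the error at most ε in each coordinate. At an
  -- early stop, the small gradient enters the maximum principle.
  rcases hT with hT | hT
  · have h2 := iterate_form_le hd hm M L hα hα2 s T
    have h3 := le_Q_form hd hα1 (X - optimum G α s)
    have h4 : (X - optimum G α s) v ^ 2 ≤ ∑ u, (X - optimum G α s) u ^ 2 :=
      single_le_sum (f := fun u => (X - optimum G α s) u ^ 2) (fun _ _ => sq_nonneg _) (mem_univ v)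
    have h5 : contraction α ^ T ≤ α ^ 2 * ε ^ 2 / (400 * (1 - α ^ 2)) := by
      have h8 : 0 < 1 - α ^ 2 := by nlinarith
      have h6 : (10 / 9) * √((1 - α) / α) *
          Real.log (400 * (1 - α ^ 2) / (α ^ 2 * ε ^ 2)) ≤ T := by
        rw [hT]; exact Nat.le_ceil _
      have h7 := sqrt_inv_ratio_mul hα hα2
      have h9 := mul_le_mul_of_nonneg_right h6
        (by have := sqrt_ratio_pos hα hα2; positivity : 0 ≤ 9 / 10 * √(α / (1 - α)))
      have h10 : Real.log (400 * (1 - α ^ 2) / (α ^ 2 * ε ^ 2)) ≤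
          T * (9 / 10 * √(α / (1 - α))) := by
        refine le_trans (le_of_eq ?_) h9
        linear_combination -Real.log (400 * (1 - α ^ 2) / (α ^ 2 * ε ^ 2)) * h7
      have h11 : contraction α ≤ Real.exp (-(9 / 10 * √(α / (1 - α)))) := by
        have := Real.add_one_le_exp (-(9 / 10 * √(α / (1 - α))))
        unfold contraction; linarith
      calc contraction α ^ T ≤ Real.exp (-(9 / 10 * √(α / (1 - α)))) ^ T :=
            pow_le_pow_left₀ (contraction_pos hα hα2).le h11 T
        _ = Real.exp (-(T * (9 / 10 * √(α / (1 - α))))) := by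
            rw [← Real.exp_nat_mul]; ring_nf
        _ ≤ Real.exp (-Real.log (400 * (1 - α ^ 2) / (α ^ 2 * ε ^ 2))) :=
            Real.exp_le_exp.2 (neg_le_neg h10)
        _ = α ^ 2 * ε ^ 2 / (400 * (1 - α ^ 2)) := by
            rw [Real.exp_neg, Real.exp_log (by positivity), inv_div]
    have h6 : α * (X - optimum G α s) v ^ 2 ≤ α * ε ^ 2 := by
      have h8 : 0 < 1 - α ^ 2 := by nlinarith
      have h7 : 400 * (1 - α ^ 2) / α * contraction α ^ T ≤
          400 * (1 - α ^ 2) / α * (α ^ 2 * ε ^ 2 / (400 * (1 - α ^ 2))) :=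
        mul_le_mul_of_nonneg_left h5 (by positivity)
      have e : 400 * (1 - α ^ 2) / α * (α ^ 2 * ε ^ 2 / (400 * (1 - α ^ 2))) = α * ε ^ 2 := by
        field_simp
      have h9 := mul_le_mul_of_nonneg_left h4 hα.le
      linarith
    have h7 : |(X - optimum G α s) v| ≤ ε :=
      abs_le_of_sq_le_sq (le_of_mul_le_mul_left h6 hα) hε.le
    rw [abs_mul, abs_of_pos (inv_pos.2 (hsq v))]
    have h8 : (√(deg G v))⁻¹ ≤ 1 := inv_le_one_of_one_le₀ (Real.one_le_sqrt.2 (hd v))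
    nlinarith [abs_nonneg ((X - optimum G α s) v)]
  · refine abs_le_of_abs_walkOp_le hd hα hα1
      (fun u => (√(deg G u))⁻¹ * (X - optimum G α s) u) (fun u => ?_) v
    have h2 : ¬ (ε * α * √(deg G u) ≤ |gradF G α s X u|) := fun h => by
      have : u ∈ {v | ε * α * √(deg G v) ≤ |gradF G α s (iterate M L α s T).1 v|} := h
      rw [hT] at this
      exact this
    rw [gradF_eq hd hα hα1, Q_mulVec_eq_walkOp hd, abs_mul, abs_of_pos (hsq u), not_le,
      mul_comm] at h2
    have := lt_of_mul_lt_mul_right h2 (hsq u).le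
    linarith

/-- The test failed at T - 1, so some gradient entry is at least αε there, while the Q-form of the
error is at most (400/α) c^{T-1}. The last factor c > 1/10 gives 4000; for T = 1, where no test
precedes, it suffices alone. -/
theorem contraction_pow_numOuter_lower (hd : ∀ v, 1 ≤ deg G v) (hm : 0 < numEdges G)
    (M : LocalSolver) (L : AdjLists G) (hα : 0 < α) (hα2 : α < 1 / 2) (hε : 0 < ε) (hε1 : ε < 1)
    (s : V) : α ^ 3 * ε ^ 2 ≤ 4000 * contraction α ^ numOuter M L α ε s := by
  have hα1 : α < 1 := by linarith
  obtain ⟨hT1, -⟩ := numOuter_mem M L s (one_le_maxOuter hα hα2 hε hε1)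
  have hcg := contraction_gt hα hα2
  obtain ⟨t, ht⟩ : ∃ t, numOuter M L α ε s = t + 1 := ⟨_, (Nat.sub_add_cancel hT1).symm⟩
  rw [ht, pow_succ (contraction α)]
  have hct : 0 < contraction α ^ t := pow_pos (contraction_pos hα hα2) t
  rcases Nat.eq_zero_or_pos t with h0 | h0
  · rw [h0, pow_zero, one_mul]
    have h1 : α ^ 3 ≤ 1 := pow_le_one₀ hα.le hα1.le
    have h2 : ε ^ 2 ≤ 1 := pow_le_one₀ hε.le hε1.le
    nlinarith [sq_nonneg ε]
  · have h1 := not_stops_of_lt M L s h0 (ht.symm ▸ Nat.lt_succ_self t : t < numOuter M L α ε s)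
    obtain ⟨v, hv⟩ := Set.nonempty_iff_ne_empty.2 h1
    have hv' : ε * α * √(deg G v) ≤ |gradF G α s (iterate M L α s t).1 v| := hv
    rw [gradF_eq hd hα hα1] at hv'
    have h2 := (sum_sq_Q_mulVec_le hd hα hα1 _).trans (iterate_form_le hd hm M L hα hα2 s t)
    have h3 := (single_le_sum
      (f := fun u => (Q G α *ᵥ ((iterate M L α s t).1 - optimum G α s)) u ^ 2)
      (fun _ _ => sq_nonneg _) (mem_univ v)).trans h2
    have h4 : (ε * α) ^ 2 ≤ (Q G α *ᵥ ((iterate M L α s t).1 - optimum G α s)) v ^ 2 := by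
      rw [← sq_abs ((Q G α *ᵥ ((iterate M L α s t).1 - optimum G α s)) v)]
      refine pow_le_pow_left₀ (by positivity) (le_trans ?_ hv') 2
      exact le_mul_of_one_le_right (by positivity) (Real.one_le_sqrt.2 (hd v))
    have h5 := h4.trans h3
    rw [div_mul_eq_mul_div, le_div_iff₀ hα] at h5
    nlinarith [sq_nonneg α]

/-- The last accuracy is of the order `α² ε²`, up to a logarithmic factor. -/
theorem sq_le_contraction_pow_numOuter (hd : ∀ v, 1 ≤ deg G v) (hm : 0 < numEdges G)
    (M : LocalSolver) (L : AdjLists G) (hα : 0 < α) (hα2 : α < 1 / 2) (hε : 0 < ε) (hε1 : ε < 1)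
    (s : V) : α ^ 2 * ε ^ 2 ≤ 4000 * Real.exp 160 * Real.log (1 / (α * ε)) ^ 2 *
      contraction α ^ numOuter M L α ε s := by
  have h1 := contraction_pow_numOuter_lower hd hm M L hα hα2 hε hε1 s
  have h2 := log_two_le_log_inv hα hα2 hε hε1
  have h3 := Real.log_two_gt_d9
  have hT := numOuter_le M L s (one_le_maxOuter hα hα2 hε hε1)
  have hct : 0 < contraction α ^ numOuter M L α ε s := pow_pos (contraction_pos hα hα2) _
  have hexp : 1 ≤ Real.exp 160 := Real.one_le_exp (by norm_num)
  set ℓ := Real.log (1 / (α * ε))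
  set c := contraction α ^ numOuter M L α ε s
  -- For small α the cap on T suffices; otherwise ℓ² ≥ 1/α supplies the factor α that the stopping
  -- test loses.
  rcases le_total (α * ℓ ^ 2) 1 with h | h
  · have h4 := contraction_pow_lower hα hα2 hε hε1 h hT
    have h5 : 1 / 10 ≤ ℓ ^ 2 := by nlinarith
    have h6 : 0 ≤ Real.exp 160 * c := by positivity
    change α ^ 2 * ε ^ 2 ≤ 400 * Real.exp 160 * c at h4
    nlinarith
  · calc α ^ 2 * ε ^ 2 ≤ α ^ 2 * ε ^ 2 * (α * ℓ ^ 2) := le_mul_of_one_le_right (by positivity) h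
      _ = (α ^ 3 * ε ^ 2) * ℓ ^ 2 := by ring
      _ ≤ (4000 * c) * ℓ ^ 2 := mul_le_mul_of_nonneg_right h1 (sq_nonneg _)
      _ ≤ (4000 * c) * ℓ ^ 2 * Real.exp 160 := le_mul_of_one_le_right (by positivity) hexp
      _ = _ := by ring

end Outer

/-! ### Bounds on the total work -/

section Complexity

variable {V : Type*} [Fintype V] [DecidableEq V] {G : SimpleGraph V} [DecidableRel G.Adj]
variable {α ε : ℝ}

theorem isLocalRun_process (hd : ∀ v, 1 ≤ deg G v) (hm : 0 < numEdges G) (M : LocalSolver)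
    (L : AdjLists G) (hα : 0 < α) (hα2 : α < 1 / 2) (s : V) (t : ℕ) :
    0 < tol M L α s t ∧ IsLocalRun G α s (iterate M L α s (t - 1)).2 (tol M L α s t)
      (process M L α s t) := by
  have h := innerTol_pos (by linarith : α < 1) s (accuracy_pos hα hα2 t) hm
    (iterate M L α s (t - 1)).2
  exact ⟨h, isLocalRun_call hd M L (by linarith) s _ _ h⟩

theorem contraction_pow_le_of_le (hα : 0 < α) (hα2 : α < 1 / 2) {t T : ℕ} (h : t ≤ T) :
    contraction α ^ T ≤ contraction α ^ t :=
  pow_le_pow_of_le_one (contraction_pos hα hα2).le (contraction_lt_one hα hα2).le h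

/-- Both C⁰ and 1/ε_t are polynomially bounded in m/(αε), the latter through the square-root entry
of the tolerance. -/
theorem log_initNorm_div_tol_le (hd : ∀ v, 1 ≤ deg G v) (hm1 : 1 ≤ numEdges G) (M : LocalSolver)
    (L : AdjLists G) (hα : 0 < α) (hα2 : α < 1 / 2) (hε : 0 < ε) (hε1 : ε < 1) (s : V) {t : ℕ}
    (ht : t ≤ numOuter M L α ε s) :
    Real.log (max (3 * initNorm M L α s t / tol M L α s t) 1) ≤
      18 * Real.log (numEdges G / (α * ε)) := by
  have hm : 0 < numEdges G := by linarith
  set m := numEdges G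
  set Λ := m / (α * ε) with hΛ
  have hΛ2 : 2 ≤ Λ := by
    rw [hΛ, le_div_iff₀ (by positivity)]
    nlinarith
  have he := (isLocalRun_process hd hm M L hα hα2 s t).1
  have h1 := initNorm_sq_le hd hm M L hα hα2 s t
  have h2 := le_innerTol_sq (by linarith : α < 1) s (accuracy_pos hα hα2 t) hm
    (iterate M L α s (t - 1)).2
  change (1 - α) * accuracy α t / m ≤ tol M L α s t ^ 2 at h2
  set e := tol M L α s t
  have h3 := contraction_pow_numOuter_lower hd hm M L hα hα2 hε hε1 s
  have h4 := contraction_pow_le_of_le hα hα2 ht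
  have h5 : α ^ 3 * ε ^ 2 / (144000 * m) ≤ e ^ 2 := by
    refine le_trans ?_ h2
    rw [accuracy_eq, div_le_div_iff₀ (by positivity) hm]
    have hc : 0 < contraction α ^ t := pow_pos (contraction_pos hα hα2) t
    have h6 : 1 / 36 * contraction α ^ t ≤
        (1 - α) * ((1 + α) / 18 * contraction α ^ t) := by
      have : 1 / 36 ≤ (1 - α) * ((1 + α) / 18) := by nlinarith
      rw [← mul_assoc]
      exact mul_le_mul_of_nonneg_right this hc.le
    have h7 : α ^ 3 * ε ^ 2 ≤
        144000 * ((1 - α) * ((1 + α) / 18 * contraction α ^ t)) := by linarith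
    have h8 := mul_le_mul_of_nonneg_right h7 hm.le
    linarith
  have h6 : (3 * initNorm M L α s t / e) ^ 2 ≤ 2 ^ 30 * Λ ^ 5 := by
    rw [div_pow, div_le_iff₀ (by positivity), mul_pow]
    have h7 : 2 ^ 30 * Λ ^ 5 * (α ^ 3 * ε ^ 2 / (144000 * m)) ≤ 2 ^ 30 * Λ ^ 5 * e ^ 2 :=
      mul_le_mul_of_nonneg_left h5 (by positivity)
    refine le_trans ?_ h7
    refine (mul_le_mul_of_nonneg_left h1 (by norm_num)).trans ?_
    have h8 : 2 ^ 30 * Λ ^ 5 * (α ^ 3 * ε ^ 2 / (144000 * m)) =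
        2 ^ 30 / 144000 * m ^ 4 / (α ^ 2 * ε ^ 3) := by
      rw [hΛ]; field_simp
    rw [h8, ← mul_div_assoc, div_le_div_iff₀ (by positivity) (by positivity)]
    have h9 : ε ^ 3 ≤ 1 := pow_le_one₀ hε.le hε1.le
    have h10 : m ≤ m ^ 4 := le_self_pow₀ hm1 (by norm_num)
    have h11 : m * ε ^ 3 ≤ m ^ 4 := by nlinarith
    have h12 := mul_le_mul_of_nonneg_left h11 (sq_nonneg α)
    have h13 : 0 ≤ α ^ 2 * m ^ 4 := by positivity
    nlinarith
  have h7 : max (3 * initNorm M L α s t / e) 1 ^ 2 ≤ 2 ^ 30 * Λ ^ 5 := by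
    rcases max_choice (3 * initNorm M L α s t / e) 1 with h | h
    · rw [h]; exact h6
    · rw [h]
      have : 1 ≤ Λ ^ 5 := one_le_pow₀ (by linarith)
      linarith
  -- Since Λ ≥ 2, twice the logarithm is at most (30 + 5) log Λ, and 35/2 < 18.
  have h8 := Real.log_le_log (pow_pos (lt_max_of_lt_right one_pos) 2) h7
  rw [Real.log_mul (by norm_num) (by positivity), Real.log_pow, Real.log_pow, Real.log_pow] at h8
  have h9 := Real.log_le_log (by norm_num) hΛ2
  push_cast at h8
  have h10 := Real.log_two_gt_d9
  linarith

theorem initNorm_le_max (M : LocalSolver) (L : AdjLists G) (s : V) {t : ℕ}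
    (ht : t ∈ Set.Icc 1 (numOuter M L α ε s)) : initNorm M L α s t ≤ maxInitNorm M L α ε s :=
  le_csSup ((Set.finite_Icc _ _).image _).bddAbove (Set.mem_image_of_mem _ ht)

theorem minTol_le (M : LocalSolver) (L : AdjLists G) (s : V) {t : ℕ}
    (ht : t ∈ Set.Icc 1 (numOuter M L α ε s)) (h0 : initNorm M L α s t ≠ 0) :
    minTol M L α ε s ≤ tol M L α s t :=
  csInf_le (((Set.finite_Icc _ _).subset (Set.sep_subset _ _)).image _).bddBelow
    (Set.mem_image_of_mem _ ⟨ht, h0⟩)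

theorem maxInitNorm_le (hd : ∀ v, 1 ≤ deg G v) (M : LocalSolver) (L : AdjLists G) (hα : 0 < α)
    (s : V) (hT : 1 ≤ numOuter M L α ε s) :
    maxInitNorm M L α ε s ≤ α * ratioR M L α ε s := by
  refine csSup_le ((Set.nonempty_Icc.2 hT).image _) ?_
  rintro _ ⟨t, ht, rfl⟩
  have h1 : initNorm M L α s t / initNorm M L α s 1 ≤ ratioR M L α ε s :=
    le_csSup ((Set.finite_Icc _ _).image
      (fun t => initNorm M L α s t / initNorm M L α s 1)).bddAbove
      (Set.mem_image_of_mem (fun t => initNorm M L α s t / initNorm M L α s 1) ht)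
  rw [initNorm_one hd M L hα, div_le_iff₀ hα] at h1
  linarith

theorem le_minTol (hd : ∀ v, 1 ≤ deg G v) (M : LocalSolver) (L : AdjLists G)
    (hα : 0 < α) (hα2 : α < 1 / 2) (s : V) (hT : 1 ≤ numOuter M L α ε s) :
    contraction α ^ numOuter M L α ε s / (18 * maxInitNorm M L α ε s) ≤ minTol M L α ε s := by
  -- Iteration 1 has C⁰ = α ≠ 0, so the infimum is not the default value of an empty set.
  refine le_csInf ⟨tol M L α s 1, Set.mem_image_of_mem _ ⟨⟨le_rfl, hT⟩, ?_⟩⟩ ?_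
  · rw [initNorm_one hd M L hα]; exact hα.ne'
  rintro _ ⟨t, ⟨ht, h0⟩, rfl⟩
  have hpos : 0 < initNorm M L α s t := (gradNorm_nonneg _ _ _ _ _).lt_of_ne' h0
  have h1 : 2 * (1 - α) * accuracy α t / initNorm M L α s t ≤ tol M L α s t := by
    unfold tol
    rw [innerTol_eq]
    exact le_max_right _ _
  refine le_trans ?_ h1
  have h2 := initNorm_le_max M L s ht
  have h3 := contraction_pow_le_of_le hα hα2 ht.2
  have hc : 0 < contraction α ^ t := pow_pos (contraction_pos hα hα2) t
  have h4 : 1 / 18 * contraction α ^ t ≤ 2 * (1 - α) * accuracy α t := by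
    rw [accuracy_eq, ← mul_assoc]
    exact mul_le_mul_of_nonneg_right (by nlinarith) hc.le
  calc contraction α ^ numOuter M L α ε s / (18 * maxInitNorm M L α ε s)
      = 1 / 18 * contraction α ^ numOuter M L α ε s / maxInitNorm M L α ε s := by
        rw [← div_div]; ring
    _ ≤ 2 * (1 - α) * accuracy α t / initNorm M L α s t :=
        div_le_div₀ (by linarith) (by linarith) hpos h2

theorem totalWork_le_of_work_le (M : LocalSolver) (L : AdjLists G) (hα : 0 < α)
    (hα2 : α < 1 / 2) (hε : 0 < ε) (hε1 : ε < 1) (s : V) {b : ℝ} (hb : 0 ≤ b)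
    (h : ∀ t ∈ Set.Icc 1 (numOuter M L α ε s), (process M L α s t).work ≤ b) :
    totalWork M L α ε s ≤ 15 * Real.log (1 / (α * ε)) / √α * b := by
  have h1 : totalWork M L α ε s ≤ numOuter M L α ε s * b := by
    unfold totalWork
    have := sum_le_card_nsmul (Finset.Icc 1 (numOuter M L α ε s)) _ b
      fun t ht => h t (by simpa using ht)
    simpa using this
  refine h1.trans (mul_le_mul_of_nonneg_right (le_trans ?_ (maxOuter_le hα hα2 hε hε1)) hb)
  exact Nat.cast_le.2 (numOuter_le M L s (one_le_maxOuter hα hα2 hε hε1))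

/-- The constant is 15 from the number of outer iterations times 27 = (3/2) · 18 from a single call.
-/
theorem totalWork_le_volRatio (hd : ∀ v, 1 ≤ deg G v) (hm1 : 1 ≤ numEdges G) (M : LocalSolver)
    (L : AdjLists G) (hα : 0 < α) (hα2 : α < 1 / 2) (hε : 0 < ε) (hε1 : ε < 1) (s : V) {tmax : ℕ}
    (hmax : IsMaxOn (volRatio M L α s) (Set.Icc 1 (numOuter M L α ε s)) tmax) :
    totalWork M L α ε s ≤
      405 * Real.log (numEdges G / (α * ε)) ^ 2 * (volRatio M L α s tmax / √α) := by
  have hm : 0 < numEdges G := by linarith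
  have h1 := log_two_le_log_inv hα hα2 hε hε1
  have h2 := Real.log_two_gt_d9
  have h3 : Real.log (1 / (α * ε)) ≤ Real.log (numEdges G / (α * ε)) :=
    Real.log_le_log (by positivity) (div_le_div_of_nonneg_right hm1 (by positivity))
  have hv : 0 ≤ volRatio M L α s tmax :=
    (isLocalRun_process hd hm M L hα hα2 s tmax).2.ratio_nonneg hm
  set ℓ := Real.log (1 / (α * ε))
  set lm := Real.log (numEdges G / (α * ε))
  have hℓ : 0 < ℓ := by linarith
  have hlm : 0 < lm := by linarith
  have hs : 0 < √α := Real.sqrt_pos.2 hα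
  refine (totalWork_le_of_work_le M L hα hα2 hε hε1 s (b := volRatio M L α s tmax * (27 * lm))
    (by positivity) fun t ht => ?_).trans ?_
  · obtain ⟨he, hrun⟩ := isLocalRun_process hd hm M L hα hα2 s t
    refine (hrun.work_le_ratio he hm).trans ?_
    refine mul_le_mul (hmax ht) ?_ ?_ hv
    · have := log_initNorm_div_tol_le hd hm1 M L hα hα2 hε hε1 s ht.2
      unfold initNorm at this
      linarith
    · exact mul_nonneg (by norm_num) (Real.log_nonneg (le_max_right _ _))
  · have e : 15 * ℓ / √α * (volRatio M L α s tmax * (27 * lm)) =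
        405 * (ℓ * lm) * (volRatio M L α s tmax / √α) := by ring
    rw [e]
    have h4 : ℓ * lm ≤ lm ^ 2 := by nlinarith
    exact mul_le_mul_of_nonneg_right (by linarith) (by positivity)

theorem maxInitNorm_pos (hd : ∀ v, 1 ≤ deg G v) (M : LocalSolver) (L : AdjLists G)
    (hα : 0 < α) (s : V) (hT : 1 ≤ numOuter M L α ε s) : 0 < maxInitNorm M L α ε s := by
  have h1 := initNorm_le_max (α := α) M L s (Set.mem_Icc.2 ⟨le_rfl, hT⟩)
  rw [initNorm_one hd M L hα s] at h1
  exact hα.trans_le h1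

theorem minTol_pos (hd : ∀ v, 1 ≤ deg G v) (M : LocalSolver) (L : AdjLists G)
    (hα : 0 < α) (hα2 : α < 1 / 2) (s : V) (hT : 1 ≤ numOuter M L α ε s) :
    0 < minTol M L α ε s :=
  lt_of_lt_of_le (div_pos (pow_pos (contraction_pos hα hα2) _)
    (mul_pos (by norm_num) (maxInitNorm_pos hd M L hα s hT))) (le_minTol hd M L hα hα2 s hT)

theorem totalWork_le_maxInitNorm (hd : ∀ v, 1 ≤ deg G v) (hm : 0 < numEdges G) (M : LocalSolver)
    (L : AdjLists G) (hα : 0 < α) (hα2 : α < 1 / 2) (hε : 0 < ε) (hε1 : ε < 1) (s : V) :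
    totalWork M L α ε s ≤ 45 / 2 * Real.log (1 / (α * ε)) *
      (maxInitNorm M L α ε s / (√α * minTol M L α ε s)) := by
  have hT := (numOuter_mem M L s (one_le_maxOuter hα hα2 hε hε1)).1
  have h1 := maxInitNorm_pos hd M L hα s hT
  have h2 := minTol_pos hd M L hα hα2 s hT
  refine (totalWork_le_of_work_le M L hα hα2 hε hε1 s
    (b := 3 / 2 * (maxInitNorm M L α ε s / minTol M L α ε s)) (by positivity)
      fun t ht => ?_).trans (le_of_eq ?_)
  · obtain ⟨he, hrun⟩ := isLocalRun_process hd hm M L hα hα2 s t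
    refine (hrun.work_le he).trans (mul_le_mul_of_nonneg_left ?_ (by norm_num))
    change initNorm M L α s t / tol M L α s t ≤ _
    by_cases h0 : initNorm M L α s t = 0
    · rw [h0, zero_div]; positivity
    · exact div_le_div₀ h1.le (initNorm_le_max M L s ht) h2 (minTol_le M L s ht h0)
  · rw [← div_div (maxInitNorm M L α ε s)]; ring

/-- With C = max C⁰, C/ε_min ≤ 18 C²/c^T ≤ 18 α²R²/c^T, and the lower bound on c^T cancels α²
exactly; 72000 = 18 · 4000. -/
theorem maxInitNorm_div_minTol_le (hd : ∀ v, 1 ≤ deg G v) (hm : 0 < numEdges G)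
    (M : LocalSolver) (L : AdjLists G) (hα : 0 < α) (hα2 : α < 1 / 2) (hε : 0 < ε)
    (hε1 : ε < 1) (s : V) :
    maxInitNorm M L α ε s / (√α * minTol M L α ε s) ≤
      72000 * Real.exp 160 * Real.log (1 / (α * ε)) ^ 2 *
        (ratioR M L α ε s ^ 2 / (√α * ε ^ 2)) := by
  have hT := (numOuter_mem M L s (one_le_maxOuter hα hα2 hε hε1)).1
  have h1 := maxInitNorm_pos hd M L hα s hT
  have h2 := minTol_pos hd M L hα hα2 s hT
  have h3 := le_minTol hd M L hα hα2 s hT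
  have h4 := maxInitNorm_le hd M L hα s hT
  have h5 := sq_le_contraction_pow_numOuter hd hm M L hα hα2 hε hε1 s
  have hc : 0 < contraction α ^ numOuter M L α ε s := pow_pos (contraction_pos hα hα2) _
  have hs : 0 < √α := Real.sqrt_pos.2 hα
  set C₀ := maxInitNorm M L α ε s
  set e := minTol M L α ε s
  set R := ratioR M L α ε s
  set c := contraction α ^ numOuter M L α ε s
  set ℓ := Real.log (1 / (α * ε))
  have h6 : C₀ * c ≤ 18 * (α * R) ^ 2 * e := by
    rw [div_le_iff₀ (by positivity)] at h3
    have h7 := mul_le_mul_of_nonneg_left h3 h1.le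
    have h8 : C₀ ^ 2 ≤ (α * R) ^ 2 := pow_le_pow_left₀ h1.le h4 2
    have h9 := mul_le_mul_of_nonneg_right h8 h2.le
    linarith
  have h10 : C₀ * ε ^ 2 ≤ 72000 * Real.exp 160 * ℓ ^ 2 * R ^ 2 * e := by
    have h11 : c * (C₀ * ε ^ 2) ≤ c * (72000 * Real.exp 160 * ℓ ^ 2 * R ^ 2 * e) := by
      have h12 := mul_le_mul_of_nonneg_right h6 (sq_nonneg ε)
      have h13 := mul_le_mul_of_nonneg_right h5 (by positivity : 0 ≤ 18 * R ^ 2 * e)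
      linarith
    exact le_of_mul_le_mul_left h11 hc
  rw [← mul_div_assoc, div_le_div_iff₀ (by positivity) (by positivity)]
  have := mul_le_mul_of_nonneg_left h10 hs.le
  linarith

end Complexity

end AESP

end

/-! ### Assembly of the bounds -/

theorem theorem3 :
    ∃ (C : ℝ) (p : ℕ), 0 < C ∧
      ∀ (V : Type*) [Fintype V] [DecidableEq V] [Nontrivial V]
        (G : SimpleGraph V) [DecidableRel G.Adj] (_ : G.Connected)
        (L : AESP.AdjLists G) (M : AESP.LocalSolver) (α ε : ℝ) (s : V),
        0 < α → α < 1 / 2 → 0 < ε → ε < 1 / AESP.deg G s →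
        -- every call of the local solver terminates
        (∀ t ∈ Set.Icc 1 (AESP.numOuter M L α ε s),
          ∃ k, (AESP.process M L α s t).halted k) ∧
        -- accuracy in the supremum norm
        ‖fun v => (AESP.result M L α ε s v - AESP.ppr G α s v) / AESP.deg G v‖ ≤ ε ∧
        -- time complexity
        ∀ tmax ∈ Set.Icc 1 (AESP.numOuter M L α ε s),
          IsMaxOn (AESP.volRatio M L α s) (Set.Icc 1 (AESP.numOuter M L α ε s)) tmax →
          -- first pair of bounds on the total work
          AESP.totalWork M L α ε s ≤
            min
              (C * Real.log (AESP.numEdges G / (α * ε)) ^ p *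
                (AESP.volRatio M L α s tmax / Real.sqrt α))
              (C * Real.log (1 / (α * ε)) ^ p *
                (AESP.maxInitNorm M L α ε s / (Real.sqrt α * AESP.minTol M L α ε s))) ∧
          -- the quantities in that pair, bounded by those in the second pair
          AESP.volRatio M L α s tmax / Real.sqrt α ≤ C * (AESP.numEdges G / Real.sqrt α) ∧
          AESP.maxInitNorm M L α ε s / (Real.sqrt α * AESP.minTol M L α ε s) ≤
            C * Real.log (1 / (α * ε)) ^ p *
              (AESP.ratioR M L α ε s ^ 2 / (Real.sqrt α * ε ^ 2)) ∧
          -- second pair of bounds on the total work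
          AESP.totalWork M L α ε s ≤
            min
              (C * Real.log (AESP.numEdges G / (α * ε)) ^ p *
                (AESP.numEdges G / Real.sqrt α))
              (C * Real.log (1 / (α * ε)) ^ p *
                (AESP.ratioR M L α ε s ^ 2 / (Real.sqrt α * ε ^ 2))) := by
  -- The last graph-independent bound is the extreme one: 1620000 = (45/2) · 72000, with 1 + 2 = 3
  -- logarithmic factors.
  refine ⟨1620000 * Real.exp 160, 3, by positivity, ?_⟩
  intro V _ _ _ G _ hG L M α ε s hα hα2 hε hεs
  have hd := AESP.one_le_deg hG
  have hε1 : ε < 1 := hεs.trans_le ((div_le_one₀ (by linarith [hd s])).2 (hd s))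
  have hm1 : 1 ≤ AESP.numEdges G := by
    have h1 : 0 < AESP.numEdges G := by
      have h2 := AESP.sum_deg (G := G)
      have h3 : 0 < ∑ v, AESP.deg G v :=
        Finset.sum_pos (fun v _ => by linarith [hd v]) ⟨s, Finset.mem_univ s⟩
      linarith
    unfold AESP.numEdges at h1 ⊢
    exact_mod_cast h1
  have hm : 0 < AESP.numEdges G := by linarith
  refine ⟨fun t _ => ?_, ?_, fun tmax _ hmax => ?_⟩
  · obtain ⟨he, hrun⟩ := AESP.isLocalRun_process hd hm M L hα hα2 s t
    exact hrun.exists_halted he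
  · refine (pi_norm_le_iff_of_nonneg hε.le).2 fun v => ?_
    exact AESP.result_accuracy hd hm M L hα hα2 hε hε1 s v
  have hℓ2 := AESP.log_two_le_log_inv hα hα2 hε hε1
  have hlog2 := Real.log_two_gt_d9
  have hℓm : Real.log (1 / (α * ε)) ≤ Real.log (AESP.numEdges G / (α * ε)) :=
    Real.log_le_log (by positivity) (div_le_div_of_nonneg_right hm1 (by positivity))
  have hT := (AESP.numOuter_mem M L s (AESP.one_le_maxOuter hα hα2 hε hε1)).1
  have hC0 := AESP.maxInitNorm_pos hd M L hα s hT
  have hmin := AESP.minTol_pos hd M L hα hα2 s hT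
  have hexp : 1 ≤ Real.exp 160 := Real.one_le_exp (by norm_num)
  have hs : 0 < √α := Real.sqrt_pos.2 hα
  have hrun := (AESP.isLocalRun_process hd hm M L hα hα2 s tmax).2
  have hv0 : 0 ≤ AESP.volRatio M L α s tmax := hrun.ratio_nonneg hm
  have hv : AESP.volRatio M L α s tmax ≤ 8 / 3 * AESP.numEdges G := hrun.ratio_le hm
  have w1 := AESP.totalWork_le_volRatio hd hm1 M L hα hα2 hε hε1 s hmax
  have w2 := AESP.totalWork_le_maxInitNorm hd hm M L hα hα2 hε hε1 s
  have w3 := AESP.maxInitNorm_div_minTol_le hd hm M L hα hα2 hε hε1 s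
  set ℓ := Real.log (1 / (α * ε))
  set lm := Real.log (AESP.numEdges G / (α * ε))
  set E := Real.exp 160
  have hℓ : 1 / 2 ≤ ℓ := by linarith
  have hlm : 1 / 2 ≤ lm := by linarith
  -- The logarithms are at least log 2 > 1/2, so lower powers can be raised to the common exponent
  -- 3.
  have p2 : ∀ x : ℝ, 1 / 2 ≤ x → x ^ 2 ≤ 2 * x ^ 3 := fun x hx => by
    nlinarith [sq_nonneg x]
  have p1 : ∀ x : ℝ, 1 / 2 ≤ x → x ≤ 4 * x ^ 3 := fun x hx => by
    nlinarith [p2 x hx]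
  have hℓ3 : 0 ≤ ℓ ^ 3 := by positivity
  have hlm3 : 0 ≤ lm ^ 3 := by positivity
  have hEℓ : ℓ ^ 3 ≤ E * ℓ ^ 3 := le_mul_of_one_le_left hℓ3 hexp
  have hElm : lm ^ 3 ≤ E * lm ^ 3 := le_mul_of_one_le_left hlm3 hexp
  have hvd : AESP.volRatio M L α s tmax / √α ≤ 8 / 3 * (AESP.numEdges G / √α) := by
    rw [← mul_div_assoc]; exact div_le_div_of_nonneg_right hv hs.le
  have hvd0 : 0 ≤ AESP.volRatio M L α s tmax / √α := by positivity
  have hmd0 : 0 ≤ AESP.numEdges G / √α := by positivity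
  have hQ0 : 0 ≤ AESP.maxInitNorm M L α ε s / (√α * AESP.minTol M L α ε s) := by positivity
  have hR0 : 0 ≤ AESP.ratioR M L α ε s ^ 2 / (√α * ε ^ 2) := by positivity
  refine ⟨le_min (w1.trans ?_) (w2.trans ?_), hvd.trans ?_, w3.trans ?_,
    le_min (w1.trans ?_) (w2.trans ?_)⟩
  · refine mul_le_mul_of_nonneg_right ?_ hvd0
    linarith [p2 lm hlm]
  · refine mul_le_mul_of_nonneg_right ?_ hQ0
    linarith [p1 ℓ hℓ]
  · refine mul_le_mul_of_nonneg_right ?_ hmd0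
    linarith
  · refine mul_le_mul_of_nonneg_right ?_ hR0
    have := mul_le_mul_of_nonneg_left (p2 ℓ hℓ) (by positivity : 0 ≤ E)
    linarith
  · refine (mul_le_mul_of_nonneg_left hvd (by positivity)).trans ?_
    rw [← mul_assoc]
    refine mul_le_mul_of_nonneg_right ?_ hmd0
    linarith [p2 lm hlm]
  · refine (mul_le_mul_of_nonneg_left w3 (by positivity)).trans ?_
    rw [← mul_assoc]
    refine mul_le_mul_of_nonneg_right (le_of_eq ?_) hR0
    ring
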